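/- Consider finite connected rooted graphs (loops and multiple edges allowed) built from $m$ labelled edges of lengths $t_1,\dots,t_m>0$ that are linearly independent over $\mathbb{Q}$. On such a graph $\Gamma$ points move with unit speed: at time $0$ one point leaves the root along each edge incident to it, and whenever one or more points arrive at a vertex they are replaced by one point leaving along each incident edge (a loop counts as two incident edges, one for each direction). Let $N_\Gamma(T)$ be the number of moving points at time $T$, equal at a point of discontinuity to half the sum of the left and right limits. Call $\Gamma$ a graph of minimal growth for $t_1,\dots,t_m$ if there is no connected rooted graph $\Gamma'$ built from the same edges such that $N_{\Gamma'}(T)<N_\Gamma(T)$ for all sufficiently large $T$. Then for every $d\in\mathbb{N}$ there is $m_0$ such that for every number of edges $m\ge m_0$, every $x>0$ and every $\varepsilon>0$ there are lengths $t_1,\dots,t_m>0$, linearly independent over $\mathbb{Q}$, with $|t_i-x|<\varepsilon$ for all $i$, for which graphs of minimal growth exist and every graph of minimal growth has root degree at least $d$. -/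

import Mathlib

/-- A finite connected rooted graph built from `m` labelled edges. Loops and multiple edges are
allowed. The vertices are numbered `0, …, n - 1`, `ends e` are the two ends of the edge `e` (in an
arbitrary order), and `root` is the source of the walk. The lengths of the edges are given
separately, as a function `t : Fin m → ℝ`. -/
structure RootedGraph (m : ℕ) where
  n : ℕ
  ends : Fin m → Fin n × Fin n
  root : Fin n
  connected : ∀ v : Fin n, Relation.ReflTransGen
    (fun u w => ∃ e : Fin m, ends e = (u, w) ∨ ends e = (w, u)) root v

namespace RootedGraph

variable {m : ℕ}

/-- An edge together with a direction of travel along it. -/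
abbrev Arc (m : ℕ) : Type := Fin m × Bool

/-- The vertex at which an arc starts. -/
def src (Γ : RootedGraph m) (a : Arc m) : Fin Γ.n :=
  if a.2 then (Γ.ends a.1).1 else (Γ.ends a.1).2

/-- The vertex at which an arc ends. -/
def tgt (Γ : RootedGraph m) (a : Arc m) : Fin Γ.n :=
  if a.2 then (Γ.ends a.1).2 else (Γ.ends a.1).1

/-- The degree of the root (a loop counts twice). -/
def rootDegree (Γ : RootedGraph m) : ℕ :=
  (Finset.univ.filter fun a : Arc m => Γ.src a = Γ.root).card

/-- `Γ.Emits t v s`: in the dynamical system on `Γ` with edge lengths `t`, points leave the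
vertex `v` at time `s`, one along every arc that starts at `v`. This happens at the root at time
`0`, and at a vertex whenever at least one point, moving with unit speed, arrives there. -/
inductive Emits (Γ : RootedGraph m) (t : Fin m → ℝ) : Fin Γ.n → ℝ → Prop
  | start : Emits Γ t Γ.root 0
  | step (a : Arc m) (s : ℝ) : Emits Γ t (Γ.src a) s → Emits Γ t (Γ.tgt a) (s + t a.1)

/-- The points moving along the graph immediately after time `T`. A moving point is recorded as
the arc it is on and the time `s` at which it entered the arc; it is then at distance `T - s` from
the start of the arc. Points that arrive at a vertex simultaneously are merged, so that there is
at most one point for each arc and each entering time. -/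
def pointsAfter (Γ : RootedGraph m) (t : Fin m → ℝ) (T : ℝ) : Set (Arc m × ℝ) :=
  {p | Γ.Emits t (Γ.src p.1) p.2 ∧ p.2 ≤ T ∧ T < p.2 + t p.1.1}

/-- The points moving along the graph immediately before time `T`. -/
def pointsBefore (Γ : RootedGraph m) (t : Fin m → ℝ) (T : ℝ) : Set (Arc m × ℝ) :=
  {p | Γ.Emits t (Γ.src p.1) p.2 ∧ p.2 < T ∧ T ≤ p.2 + t p.1.1}

/-- `N(T)`, the number of moving points at time `T`; at a point of discontinuity it is half the
sum of the limits from the left and from the right. -/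
noncomputable def numPoints (Γ : RootedGraph m) (t : Fin m → ℝ) (T : ℝ) : ℝ :=
  (((Γ.pointsBefore t T).ncard : ℝ) + ((Γ.pointsAfter t T).ncard : ℝ)) / 2

/-- `Γ` is a graph of minimal growth for the edge lengths `t`: no connected rooted graph built
from the same edges has, for all sufficiently large times, strictly fewer moving points. -/
def IsMinimalGrowth (Γ : RootedGraph m) (t : Fin m → ℝ) : Prop :=
  ∀ Γ' : RootedGraph m, ¬ ∀ᶠ T : ℝ in Filter.atTop, Γ'.numPoints t T < Γ.numPoints t T

end RootedGraph

open Filter Topology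

/-! Every graph unfolds to a tree on the same edges: each edge is hung from one chosen edge that
enters its near end (`RootedGraph.exists_unfolding`). The points on the tree inject into those on
the graph, and so do the arcs leaving the root. Hence the tree has no more points and no larger root
degree (`RootedGraph.exists_tree_numPoints_le`), and only trees need to be compared.

On a tree, the emission times at `v` are the sums `∑ t i * k i` where `k` is odd exactly on the path
to `v` and the used edges contain their parents (`treeEmits_iff`). Rational independence lets `k` be
recovered from the sum, so points are counted by lattice vectors in simplices (`ncard_tourSet`).
With `n + 2` edges the term of order `T ^ (n + 1)` is common to all trees. The next coefficient is a
common increasing affine function of `growthCost`, which weighs depths of edges against leaves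
(`tendsto_ncard_pointsAfter`). A smaller cost therefore means eventually fewer points.

For equal lengths the cost is proportional to the integer `treeCost`, the sum of depths plus `2 * m
- 1` per leaf. There are finitely many trees, so by continuity strict inequalities between these
integers survive at independent lengths near `x`. Branching away from the root is never optimal.
Without it, a root of degree below `d` forces a depth sum of about `m ^ 2 / (4 * d)` or more, and
for large `m` a spider with `8 * d` legs is cheaper (`exists_treeCost_lt`). -/

/-- Lattice vectors with prescribed support `S` and weighted size at most `X`. -/
def latticeSet {ι : Type*} [Fintype ι] (a : ι → ℝ) (S : Finset ι) (X : ℝ) : Set (ι → ℕ) :=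
  {k | (∀ i, 1 ≤ k i ↔ i ∈ S) ∧ ∑ i, a i * k i ≤ X}

/-- The number of lattice vectors with prescribed support `S` and weighted size at most `X`. -/
noncomputable def latticeCount {ι : Type*} [Fintype ι] (a : ι → ℝ) (S : Finset ι) (X : ℝ) : ℝ :=
  (latticeSet a S X).ncard

/-! ### Asymptotics of lattice point counts in simplices. -/

section Lattice

variable {ι : Type*} [Fintype ι] {a : ι → ℝ}

theorem finite_weighted_le (ha : ∀ i, 0 < a i) (X : ℝ) :
    {k : ι → ℕ | ∑ i, a i * k i ≤ X}.Finite := by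
  classical
  refine (Set.Finite.pi' (fun i : ι => Set.finite_Iic ⌊X / a i⌋₊)).subset ?_
  intro k hk i
  have h1 : a i * k i ≤ X :=
    (Finset.single_le_sum (f := fun i => a i * (k i : ℝ))
      (fun j _ => mul_nonneg (ha j).le (Nat.cast_nonneg _)) (Finset.mem_univ i)).trans hk
  refine Nat.le_floor ?_
  rw [le_div_iff₀ (ha i)]
  linarith

theorem latticeSet_finite (ha : ∀ i, 0 < a i) (S : Finset ι) (X : ℝ) :
    (latticeSet a S X).Finite :=
  (finite_weighted_le ha X).subset fun _ hk => hk.2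

theorem latticeCount_nonneg (S : Finset ι) (X : ℝ) : 0 ≤ latticeCount a S X :=
  Nat.cast_nonneg _

theorem latticeCount_mono (ha : ∀ i, 0 < a i) (S : Finset ι) : Monotone (latticeCount a S) := by
  intro X Y h
  exact Nat.cast_le.2 (Set.ncard_le_ncard (fun k hk => ⟨hk.1, hk.2.trans h⟩)
    (latticeSet_finite ha S Y))

theorem latticeCount_of_neg (ha : ∀ i, 0 < a i) (S : Finset ι) {X : ℝ} (hX : X < 0) :
    latticeCount a S X = 0 := by
  have : latticeSet a S X = ∅ := by
    ext k
    simp only [latticeSet, Set.mem_ofPred_eq, Set.mem_empty_iff_false, iff_false, not_and, not_le]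
    intro _
    exact hX.trans_le (Finset.sum_nonneg fun i _ => mul_nonneg (ha i).le (Nat.cast_nonneg _))
  simp [latticeCount, this]

theorem latticeCount_empty {X : ℝ} (hX : 0 ≤ X) : latticeCount a ∅ X = 1 := by
  have : latticeSet a ∅ X = {0} := by
    ext k
    simp only [latticeSet, Set.mem_ofPred_eq, Finset.notMem_empty, iff_false, not_le,
      Nat.lt_one_iff, Set.mem_singleton_iff]
    constructor
    · exact fun h => funext h.1
    · rintro rfl
      simpa using hX
  simp [latticeCount, this]

theorem sum_weighted_add_single [DecidableEq ι] (e : ι) (k : ι → ℕ) :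
    ∑ i, a i * ((k + Pi.single e 1 : ι → ℕ) i : ℝ) = ∑ i, a i * k i + a e := by
  simp [Pi.single_apply, mul_add, Finset.sum_add_distrib]

/-- Lowering the coordinate at `e` by one either keeps `e` in the support or removes it. This exact
recursion yields both the volume bounds and the count in short windows. -/
theorem latticeCount_eq_add [DecidableEq ι] (ha : ∀ i, 0 < a i) {S : Finset ι} {e : ι}
    (he : e ∈ S) (X : ℝ) :
    latticeCount a S X = latticeCount a S (X - a e) + latticeCount a (S.erase e) (X - a e) := by
  have hinj : Function.Injective (fun k : ι → ℕ => k + Pi.single e 1) := add_left_injective _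
  have himg : latticeSet a S X = (fun k : ι → ℕ => k + Pi.single e 1) ''
      (latticeSet a S (X - a e) ∪ latticeSet a (S.erase e) (X - a e)) := by
    ext k
    constructor
    · rintro ⟨h1, h2⟩
      have hke : 1 ≤ k e := (h1 e).2 he
      have hk : k - Pi.single e 1 + Pi.single e 1 = k := by
        funext i
        by_cases hi : i = e
        · subst hi; simp; omega
        · simp [hi]
      refine ⟨k - Pi.single e 1, ?_, hk⟩
      have h3 : ∑ i, a i * ((k - Pi.single e 1 : ι → ℕ) i : ℝ) ≤ X - a e := by
        have := sum_weighted_add_single (a := a) e (k - Pi.single e 1)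
        rw [hk] at this
        linarith
      by_cases h4 : 2 ≤ k e
      · left
        refine ⟨fun i => ?_, h3⟩
        by_cases hi : i = e
        · subst hi; simp [he]; omega
        · simpa [hi] using h1 i
      · right
        refine ⟨fun i => ?_, h3⟩
        by_cases hi : i = e
        · subst hi; simp; omega
        · simpa [hi] using h1 i
    · rintro ⟨k, hk | hk, rfl⟩
      · refine ⟨fun i => ?_, ?_⟩
        · by_cases hi : i = e
          · subst hi; simp [he]
          · simpa [hi] using hk.1 i
        · rw [sum_weighted_add_single]; linarith [hk.2]
      · refine ⟨fun i => ?_, ?_⟩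
        · by_cases hi : i = e
          · subst hi; simp [he]
          · simpa [hi] using hk.1 i
        · rw [sum_weighted_add_single]; linarith [hk.2]
  have hdisj : Disjoint (latticeSet a S (X - a e)) (latticeSet a (S.erase e) (X - a e)) := by
    rw [Set.disjoint_left]
    intro k h1 h2
    have := (h2.1 e).1 ((h1.1 e).2 he)
    simp at this
  unfold latticeCount
  rw [himg, Set.ncard_image_of_injective _ hinj,
    Set.ncard_union_eq hdisj (latticeSet_finite ha _ _) (latticeSet_finite ha _ _), Nat.cast_add]

theorem pow_succ_sub_pow_succ_le {y z : ℝ} (hz : 0 ≤ z) (hzy : z ≤ y) (n : ℕ) :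
    y ^ (n + 1) - z ^ (n + 1) ≤ (n + 1) * (y - z) * y ^ n := by
  induction n with
  | zero => simp
  | succ n ih =>
    have h1 : z ^ (n + 1) ≤ y ^ (n + 1) := pow_le_pow_left₀ hz hzy _
    have h2 := mul_le_mul_of_nonneg_left ih (hz.trans hzy)
    have h3 := mul_le_mul_of_nonneg_left h1 (sub_nonneg.2 hzy)
    push_cast
    calc y ^ (n + 1 + 1) - z ^ (n + 1 + 1)
        = y * (y ^ (n + 1) - z ^ (n + 1)) + (y - z) * z ^ (n + 1) := by ring
      _ ≤ y * ((n + 1) * (y - z) * y ^ n) + (y - z) * y ^ (n + 1) := add_le_add h2 h3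
      _ = _ := by ring

theorem le_pow_succ_sub_pow_succ {y z : ℝ} (hz : 0 ≤ z) (hzy : z ≤ y) (n : ℕ) :
    (n + 1) * (y - z) * z ^ n ≤ y ^ (n + 1) - z ^ (n + 1) := by
  induction n with
  | zero => simp
  | succ n ih =>
    have h1 : z ^ (n + 1) ≤ y ^ (n + 1) := pow_le_pow_left₀ hz hzy _
    have h2 := mul_le_mul_of_nonneg_left ih hz
    have h3 := mul_le_mul_of_nonneg_left h1 (sub_nonneg.2 hzy)
    push_cast
    calc ((n : ℝ) + 1 + 1) * (y - z) * z ^ (n + 1)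
        = z * ((n + 1) * (y - z) * z ^ n) + (y - z) * z ^ (n + 1) := by ring
      _ ≤ z * (y ^ (n + 1) - z ^ (n + 1)) + (y - z) * y ^ (n + 1) := add_le_add h2 h3
      _ = _ := by ring

/-- Induction on a real number in steps of fixed length. -/
theorem real_step_induction {P : ℝ → Prop} {h : ℝ} (hh : 0 < h) (hneg : ∀ X < 0, P X)
    (hstep : ∀ X, 0 ≤ X → P (X - h) → P X) (X : ℝ) : P X := by
  have key : ∀ j : ℕ, ∀ X : ℝ, X < j * h → P X := by
    intro j
    induction j with
    | zero => intro X hX; exact hneg X (by simpa using hX)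
    | succ j ih =>
      intro X hX
      rcases lt_or_ge X 0 with h0 | h0
      · exact hneg X h0
      · refine hstep X h0 (ih _ ?_)
        push_cast at hX
        linarith
  obtain ⟨j, hj⟩ := exists_nat_gt (X / h)
  exact key j X ((div_lt_iff₀ hh).1 hj)

/-- The bound is the volume of a simplex: unit cubes with upper corners at the lattice points, taken
in the coordinates of `S`, are disjoint and lie inside it. The induction obtains it from the
recursion at `e`. -/
theorem latticeCount_le (ha : ∀ i, 0 < a i) (S : Finset ι) (X : ℝ) :
    latticeCount a S X ≤ (max X 0) ^ S.card / (S.card.factorial * ∏ i ∈ S, a i) := by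
  classical
  induction S using Finset.induction_on generalizing X with
  | empty =>
    rcases lt_or_ge X 0 with h | h
    · simp [latticeCount_of_neg ha ∅ h]
    · simp [latticeCount_empty h]
  | insert e S he ih =>
    have hc : 0 < (S.card.factorial : ℝ) * ∏ i ∈ S, a i :=
      mul_pos (by positivity) (Finset.prod_pos fun i _ => ha i)
    set c := (S.card.factorial : ℝ) * ∏ i ∈ S, a i with hcdef
    have hden : (((insert e S).card.factorial : ℕ) : ℝ) * ∏ i ∈ insert e S, a i
        = (S.card + 1) * a e * c := by
      rw [Finset.card_insert_of_notMem he, Finset.prod_insert he, Nat.factorial_succ]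
      push_cast
      rw [hcdef]; ring
    rw [hden, Finset.card_insert_of_notMem he]
    have hae := ha e
    have hd : 0 < ((S.card : ℝ) + 1) * a e * c := by positivity
    refine real_step_induction (P := fun X => latticeCount a (insert e S) X ≤
      (max X 0) ^ (S.card + 1) / ((S.card + 1) * a e * c)) (ha e) ?_ ?_ X
    · intro X hX
      rw [latticeCount_of_neg ha _ hX]
      positivity
    · intro X hX hprev
      rw [latticeCount_eq_add ha (Finset.mem_insert_self e S), Finset.erase_insert he]
      rcases lt_or_ge (X - a e) 0 with h | h
      · rw [latticeCount_of_neg ha _ h, latticeCount_of_neg ha _ h, add_zero]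
        positivity
      · have h2 := ih (X - a e)
        rw [max_eq_left h] at hprev h2
        rw [max_eq_left hX]
        have h3 := le_pow_succ_sub_pow_succ h (by linarith : X - a e ≤ X) S.card
        rw [sub_sub_cancel] at h3
        have h4 : (X - a e) ^ S.card / c
            = ((S.card + 1) * a e * (X - a e) ^ S.card) / ((S.card + 1) * a e * c) := by
          field_simp
        calc _ ≤ _ := add_le_add hprev h2
          _ ≤ _ := by
            rw [h4, ← add_div]
            exact div_le_div_of_nonneg_right (by linarith) hd.le

/-- The same cubes cover the simplex whose size is reduced by `∑ i ∈ S, a i`, since rounding up adds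
at most one to each coordinate. -/
theorem le_latticeCount (ha : ∀ i, 0 < a i) (S : Finset ι) (X : ℝ) (hX : 0 ≤ X) :
    (max (X - ∑ i ∈ S, a i) 0) ^ S.card / (S.card.factorial * ∏ i ∈ S, a i)
      ≤ latticeCount a S X := by
  classical
  induction S using Finset.induction_on generalizing X with
  | empty => simp [latticeCount_empty hX]
  | insert e S he ih =>
    have hc : 0 < (S.card.factorial : ℝ) * ∏ i ∈ S, a i :=
      mul_pos (by positivity) (Finset.prod_pos fun i _ => ha i)
    set c := (S.card.factorial : ℝ) * ∏ i ∈ S, a i with hcdef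
    have hden : (((insert e S).card.factorial : ℕ) : ℝ) * ∏ i ∈ insert e S, a i
        = (S.card + 1) * a e * c := by
      rw [Finset.card_insert_of_notMem he, Finset.prod_insert he, Nat.factorial_succ]
      push_cast
      rw [hcdef]; ring
    rw [hden, Finset.card_insert_of_notMem he, Finset.sum_insert he]
    have hae := ha e
    have hd : 0 < ((S.card : ℝ) + 1) * a e * c := by positivity
    have hA : 0 ≤ ∑ i ∈ S, a i := Finset.sum_nonneg fun i _ => (ha i).le
    refine real_step_induction (P := fun X => (max (X - (a e + ∑ i ∈ S, a i)) 0) ^ (S.card + 1) /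
      ((S.card + 1) * a e * c) ≤ latticeCount a (insert e S) X) (ha e) ?_ ?_ X
    · intro X hX
      rw [max_eq_right (by linarith)]
      simp [latticeCount_nonneg]
    · intro X hX hprev
      rcases lt_or_ge (X - (a e + ∑ i ∈ S, a i)) 0 with h | h
      · rw [max_eq_right h.le]
        simp [latticeCount_nonneg]
      rw [latticeCount_eq_add ha (Finset.mem_insert_self e S), Finset.erase_insert he]
      have h2 := ih (X - a e) (by linarith)
      rw [max_eq_left h]
      rw [show X - a e - ∑ i ∈ S, a i = X - (a e + ∑ i ∈ S, a i) by ring, max_eq_left h] at h2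
      set y := X - (a e + ∑ i ∈ S, a i) with hy
      rw [show X - a e - (a e + ∑ i ∈ S, a i) = y - a e by rw [hy]; ring] at hprev
      have h3 := pow_succ_sub_pow_succ_le (le_max_right (y - a e) 0)
        (max_le (by linarith) h : max (y - a e) 0 ≤ y) S.card
      have h5 : y - max (y - a e) 0 ≤ a e := by linarith [le_max_left (y - a e) 0]
      have h6 : ((S.card : ℝ) + 1) * (y - max (y - a e) 0) * y ^ S.card
          ≤ (S.card + 1) * a e * y ^ S.card := by gcongr
      have h4 : y ^ S.card / c
          = ((S.card + 1) * a e * y ^ S.card) / ((S.card + 1) * a e * c) := by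
        field_simp
      refine le_trans ?_ (add_le_add hprev h2)
      rw [h4, ← add_div]
      exact div_le_div_of_nonneg_right (by linarith) hd.le

theorem tendsto_add_div_self (h : ℝ) : Tendsto (fun X : ℝ => (X + h) / X) atTop (𝓝 1) := by
  have h1 : Tendsto (fun X : ℝ => 1 + h / X) atTop (𝓝 (1 + 0)) :=
    tendsto_const_nhds.add (tendsto_const_nhds.div_atTop tendsto_id)
  rw [add_zero] at h1
  refine h1.congr' ?_
  filter_upwards [eventually_gt_atTop 0] with X hX
  field_simp

theorem tendsto_shift_div_pow {f : ℝ → ℝ} {n : ℕ} {c : ℝ}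
    (hf : Tendsto (fun X => f X / X ^ n) atTop (𝓝 c)) (h : ℝ) :
    Tendsto (fun X => f (X + h) / X ^ n) atTop (𝓝 c) := by
  have h1 := (hf.comp (tendsto_atTop_add_const_right atTop h tendsto_id)).mul
    ((tendsto_add_div_self h).pow n)
  simp only [one_pow, mul_one] at h1
  refine h1.congr' ?_
  filter_upwards [eventually_gt_atTop 0, eventually_gt_atTop (-h)] with X hX hX'
  have : X + h ≠ 0 := by linarith
  simp only [Function.comp, id]
  rw [div_pow]
  field_simp

theorem tendsto_latticeCount (ha : ∀ i, 0 < a i) (S : Finset ι) :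
    Tendsto (fun X => latticeCount a S X / X ^ S.card) atTop
      (𝓝 (1 / (S.card.factorial * ∏ i ∈ S, a i))) := by
  have hc : 0 < (S.card.factorial : ℝ) * ∏ i ∈ S, a i :=
    mul_pos (by positivity) (Finset.prod_pos fun i _ => ha i)
  set c := (S.card.factorial : ℝ) * ∏ i ∈ S, a i with hcdef
  set A := ∑ i ∈ S, a i with hA
  have hlow : Tendsto (fun X : ℝ => ((X + -A) / X) ^ S.card / c) atTop (𝓝 (1 / c)) := by
    simpa using ((tendsto_add_div_self (-A)).pow S.card).div_const c
  refine tendsto_of_tendsto_of_tendsto_of_le_of_le' hlow tendsto_const_nhds ?_ ?_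
  · filter_upwards [eventually_gt_atTop 0, eventually_ge_atTop A] with X hX hXA
    have h1 := le_latticeCount ha S X hX.le
    rw [← hA, max_eq_left (by linarith), ← hcdef] at h1
    rw [le_div_iff₀ (by positivity), div_pow]
    refine le_trans (le_of_eq ?_) h1
    rw [← sub_eq_add_neg]
    field_simp
  · filter_upwards [eventually_gt_atTop 0] with X hX
    have h1 := latticeCount_le ha S X
    rw [max_eq_left hX.le, ← hcdef] at h1
    rw [div_le_iff₀ (by positivity)]
    refine h1.trans (le_of_eq ?_)
    ring

theorem tendsto_div_pow_of_lt {f : ℝ → ℝ} {n k : ℕ} {c : ℝ} (hnk : n < k)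
    (hf : Tendsto (fun X => f X / X ^ n) atTop (𝓝 c)) :
    Tendsto (fun X => f X / X ^ k) atTop (𝓝 0) := by
  have h1 : Tendsto (fun X : ℝ => (X ^ (k - n))⁻¹) atTop (𝓝 0) :=
    (tendsto_pow_atTop (by omega)).inv_tendsto_atTop
  have h2 := hf.mul h1
  rw [mul_zero] at h2
  refine h2.congr' ?_
  filter_upwards [eventually_gt_atTop 0] with X hX
  have : X ^ k = X ^ n * X ^ (k - n) := by rw [← pow_add]; congr 1; omega
  rw [this]
  field_simp

/-- The lengths `h` for which the limit holds form a group. By the recursion it contains `a e` and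
`a f`, so it is dense as their ratio is irrational. Monotonicity of the count then squeezes every
other `h` between members of the group. -/
theorem tendsto_latticeCount_window [DecidableEq ι] (ha : ∀ i, 0 < a i) {S : Finset ι} {n : ℕ}
    (hS : S.card = n + 1) {e f : ι} (he : e ∈ S) (hf : f ∈ S) (hef : Irrational (a e / a f))
    (h : ℝ) :
    Tendsto (fun X => (latticeCount a S (X + h) - latticeCount a S X) / X ^ n) atTop
      (𝓝 (h * (1 / (n.factorial * ∏ i ∈ S, a i)))) := by
  set c : ℝ := 1 / (n.factorial * ∏ i ∈ S, a i) with hc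
  have hcpos : 0 < c := by
    have : 0 < ∏ i ∈ S, a i := Finset.prod_pos fun i _ => ha i
    positivity
  set G := latticeCount a S with hG
  let P : ℝ → Prop := fun h => Tendsto (fun X => (G (X + h) - G X) / X ^ n) atTop (𝓝 (h * c))
  have hgen : ∀ g ∈ S, P (a g) := by
    intro g hg
    have h1 := tendsto_latticeCount ha (S.erase g)
    have hcard : (S.erase g).card = n := by rw [Finset.card_erase_of_mem hg, hS]; rfl
    rw [hcard] at h1
    have h2 : 1 / ((n.factorial : ℝ) * ∏ i ∈ S.erase g, a i) = a g * c := by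
      rw [hc, ← Finset.mul_prod_erase S a hg]
      have := (ha g).ne'
      have : ∏ i ∈ S.erase g, a i ≠ 0 := (Finset.prod_pos fun i _ => ha i).ne'
      field_simp
    rw [h2] at h1
    refine h1.congr fun X => ?_
    have := latticeCount_eq_add ha hg (X + a g)
    rw [add_sub_cancel_right] at this
    rw [hG, this, add_sub_cancel_left]
  have hadd : ∀ x y, P x → P y → P (x + y) := by
    intro x y hx hy
    have h1 := (tendsto_shift_div_pow (f := fun X => G (X + y) - G X) hy x).add hx
    have : y * c + x * c = (x + y) * c := by ring
    rw [this] at h1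
    refine h1.congr fun X => ?_
    rw [← add_div, ← add_assoc X x y]
    congr 1
    ring
  have hneg : ∀ x, P x → P (-x) := by
    intro x hx
    have h1 := (tendsto_shift_div_pow (f := fun X => G (X + x) - G X) hx (-x)).neg
    rw [← neg_mul] at h1
    refine h1.congr fun X => ?_
    rw [← neg_div, neg_add_cancel_right, neg_sub]
  have hclos : ∀ x ∈ AddSubgroup.closure {a e, a f}, P x := by
    intro x hx
    induction hx using AddSubgroup.closure_induction with
    | mem x hx =>
      rcases hx with rfl | rfl
      · exact hgen e he
      · exact hgen f hf
    | zero => simp [P]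
    | add x y _ _ hx hy => exact hadd x y hx hy
    | neg x _ hx => exact hneg x hx
  have hdense := dense_addSubgroupClosure_pair_iff.2 hef
  have hmono : Monotone G := latticeCount_mono ha S
  rw [tendsto_order]
  constructor
  · intro b hb
    rw [← div_lt_iff₀ hcpos] at hb
    obtain ⟨y, hy, hy1, hy2⟩ := hdense.exists_between hb
    filter_upwards [(tendsto_order.1 (hclos y hy)).1 b ((div_lt_iff₀ hcpos).1 hy1),
      eventually_gt_atTop 0] with X hX hX0
    refine hX.trans_le (div_le_div_of_nonneg_right ?_ (by positivity))
    exact sub_le_sub_right (hmono (by linarith)) _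
  · intro b hb
    rw [gt_iff_lt, ← lt_div_iff₀ hcpos] at hb
    obtain ⟨y, hy, hy1, hy2⟩ := hdense.exists_between hb
    filter_upwards [(tendsto_order.1 (hclos y hy)).2 b ((lt_div_iff₀ hcpos).1 hy2),
      eventually_gt_atTop 0] with X hX hX0
    refine lt_of_le_of_lt (div_le_div_of_nonneg_right ?_ (by positivity)) hX
    exact sub_le_sub_right (hmono (by linarith)) _

end Lattice

/-! ### Rooted trees encoded by parent functions. -/

/-- A rooted forest on the edges: `p e` is the edge preceding `e` on the way from the root, or
`none` if `e` starts at the root. The existence of a rank function excludes cycles. -/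
def IsParent {m : ℕ} (p : Fin m → Option (Fin m)) : Prop :=
  ∃ rank : Fin m → ℕ, ∀ e f, p e = some f → rank f < rank e

/-- The edges on the way from the root to the vertex `v`, where `none` is the root and `some e`
is the far end of the edge `e`. -/
noncomputable def rootPath {m : ℕ} (p : Fin m → Option (Fin m)) (v : Option (Fin m)) :
    Finset (Fin m) := by
  classical
  exact Finset.univ.filter fun f => ∃ j : ℕ, (fun w : Option (Fin m) => w.bind p)^[j] v = some f

/-- A set of edges that contains with every edge its parent. -/
def ParentClosed {m : ℕ} (p : Fin m → Option (Fin m)) (S : Finset (Fin m)) : Prop :=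
  ∀ e f, p e = some f → e ∈ S → f ∈ S

section Parent

variable {m : ℕ} {p : Fin m → Option (Fin m)}

theorem mem_rootPath {v : Option (Fin m)} {f : Fin m} : f ∈ rootPath p v ↔
    ∃ j : ℕ, (fun w : Option (Fin m) => w.bind p)^[j] v = some f := by
  simp [rootPath]

theorem rootPath_none : rootPath p none = ∅ := by
  ext f
  have : ∀ j : ℕ, (fun w : Option (Fin m) => w.bind p)^[j] none = none := fun j =>
    Function.iterate_fixed rfl j
  simp [mem_rootPath, this]

theorem rootPath_some (e : Fin m) : rootPath p (some e) = insert e (rootPath p (p e)) := by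
  ext f
  rw [Finset.mem_insert, mem_rootPath, mem_rootPath]
  constructor
  · rintro ⟨j, hj⟩
    cases j with
    | zero => left; simpa using hj.symm
    | succ j => right; exact ⟨j, by simpa [Function.iterate_succ_apply] using hj⟩
  · rintro (rfl | ⟨j, hj⟩)
    · exact ⟨0, rfl⟩
    · exact ⟨j + 1, by simpa [Function.iterate_succ_apply] using hj⟩

theorem rank_lt_of_mem_rootPath {rank : Fin m → ℕ} (hr : ∀ e f, p e = some f → rank f < rank e)
    (e f : Fin m) (h : f ∈ rootPath p (p e)) : rank f < rank e := by
  induction hn : rank e using Nat.strong_induction_on generalizing e with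
  | _ n ih =>
    subst hn
    cases hpe : p e with
    | none => rw [hpe, rootPath_none] at h; simp at h
    | some g =>
      rw [hpe, rootPath_some, Finset.mem_insert] at h
      have hg := hr e g hpe
      rcases h with rfl | h
      · exact hg
      · exact (ih _ hg g h rfl).trans hg

theorem notMem_rootPath (hp : IsParent p) (e : Fin m) : e ∉ rootPath p (p e) := by
  obtain ⟨rank, hr⟩ := hp
  exact fun h => lt_irrefl _ (rank_lt_of_mem_rootPath hr e e h)

theorem parentClosed_univ : ParentClosed p Finset.univ := fun _ _ _ _ => Finset.mem_univ _

/-- `IsTour p v k`: the vector `k` of numbers of passages is realized by a walk from the root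
to `v` in the tree with parent function `p`. -/
def IsTour (p : Fin m → Option (Fin m)) (v : Option (Fin m)) (k : Fin m → ℕ) : Prop :=
  (∀ f, Odd (k f) ↔ f ∈ rootPath p v) ∧ ∀ e f, p e = some f → 0 < k e → 0 < k f

end Parent

/-- The rooted tree with parent function `p`. -/
noncomputable def treeGraph {m : ℕ} (p : Fin m → Option (Fin m)) (hp : IsParent p) :
    RootedGraph m where
  n := m + 1
  ends e := ((finSuccEquiv m).symm (p e), (finSuccEquiv m).symm (some e))
  root := (finSuccEquiv m).symm none
  connected := by
    obtain ⟨rank, hr⟩ := hp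
    have key : ∀ w : Option (Fin m), Relation.ReflTransGen
        (fun u w => ∃ e : Fin m,
          ((finSuccEquiv m).symm (p e), (finSuccEquiv m).symm (some e)) = (u, w) ∨
          ((finSuccEquiv m).symm (p e), (finSuccEquiv m).symm (some e)) = (w, u))
        ((finSuccEquiv m).symm none) ((finSuccEquiv m).symm w) := by
      intro w
      cases w with
      | none => exact Relation.ReflTransGen.refl
      | some e =>
        induction hn : rank e using Nat.strong_induction_on generalizing e with
        | _ n ih =>
          subst hn
          refine Relation.ReflTransGen.tail (b := (finSuccEquiv m).symm (p e)) ?_ ⟨e, Or.inl rfl⟩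
          cases hpe : p e with
          | none => exact Relation.ReflTransGen.refl
          | some g => exact ih _ (hr e g hpe) g rfl
    intro v
    have := key (finSuccEquiv m v)
    rwa [Equiv.symm_apply_apply] at this

/-! ### Walks on trees and their passage vectors. -/

section Tree

variable {m : ℕ} {p : Fin m → Option (Fin m)} {t : Fin m → ℝ}

/-- The start of an arc of the tree with parent function `p`. -/
def arcSrc (p : Fin m → Option (Fin m)) (a : RootedGraph.Arc m) : Option (Fin m) :=
  if a.2 then p a.1 else some a.1

/-- The end of an arc of the tree with parent function `p`. -/
def arcTgt (p : Fin m → Option (Fin m)) (a : RootedGraph.Arc m) : Option (Fin m) :=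
  if a.2 then some a.1 else p a.1

theorem treeGraph_src (hp : IsParent p) (a : RootedGraph.Arc m) :
    (treeGraph p hp).src a = (finSuccEquiv m).symm (arcSrc p a) := by
  unfold RootedGraph.src arcSrc
  split_ifs <;> rfl

theorem treeGraph_tgt (hp : IsParent p) (a : RootedGraph.Arc m) :
    (treeGraph p hp).tgt a = (finSuccEquiv m).symm (arcTgt p a) := by
  unfold RootedGraph.tgt arcTgt
  split_ifs <;> rfl

/-- Emission in the tree with parent function `p`, with vertices in `Option (Fin m)`. -/
def TreeEmits (p : Fin m → Option (Fin m)) (hp : IsParent p) (t : Fin m → ℝ)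
    (v : Option (Fin m)) (s : ℝ) : Prop :=
  (treeGraph p hp).Emits t ((finSuccEquiv m).symm v) s

theorem TreeEmits.step (hp : IsParent p) (a : RootedGraph.Arc m) {s : ℝ}
    (h : TreeEmits p hp t (arcSrc p a) s) : TreeEmits p hp t (arcTgt p a) (s + t a.1) := by
  unfold TreeEmits at *
  rw [← treeGraph_src hp] at h
  rw [← treeGraph_tgt hp]
  exact RootedGraph.Emits.step a s h

theorem isTour_zero : IsTour p none 0 := by
  refine ⟨fun f => ?_, fun e f _ h => ?_⟩
  · simp [rootPath_none]
  · simp at h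

theorem IsTour.step (hp : IsParent p) (a : RootedGraph.Arc m) {k : Fin m → ℕ}
    (h : IsTour p (arcSrc p a) k) : IsTour p (arcTgt p a) (k + Pi.single a.1 1) := by
  obtain ⟨e, b⟩ := a
  obtain ⟨h1, h2⟩ := h
  have he := notMem_rootPath hp e
  have hpar : ∀ f, Odd ((k + Pi.single e 1 : Fin m → ℕ) f) ↔
      f ∈ rootPath p (arcTgt p (e, b)) := by
    intro f
    by_cases hfe : f = e
    · subst hfe
      have := h1 f
      cases b <;> simp_all [arcSrc, arcTgt, rootPath_some, Nat.odd_add_one]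
    · have := h1 f
      cases b <;> simp_all [arcSrc, arcTgt, rootPath_some]
  refine ⟨hpar, fun c f hcf hc => ?_⟩
  by_cases hce : c = e
  · subst hce
    suffices 0 < k f by simp only [Pi.add_apply]; omega
    cases b with
    | true =>
      refine ((h1 f).2 ?_).pos
      simp [arcSrc, hcf, rootPath_some]
    | false =>
      refine h2 c f hcf ((h1 c).2 ?_).pos
      simp [arcSrc, rootPath_some]
  · have : 0 < k f := h2 c f hcf (by simpa [hce] using hc)
    simp only [Pi.add_apply]; omega

theorem exists_isTour_of_treeEmits (hp : IsParent p) {v : Option (Fin m)} {s : ℝ}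
    (h : TreeEmits p hp t v s) : ∃ k, IsTour p v k ∧ s = ∑ i, t i * k i := by
  have key : ∀ (w : Fin (treeGraph p hp).n) (s : ℝ), (treeGraph p hp).Emits t w s →
      ∀ v, (finSuccEquiv m).symm v = w → ∃ k, IsTour p v k ∧ s = ∑ i, t i * k i := by
    intro w s h
    induction h with
    | start =>
      intro v hw
      have : v = none := (finSuccEquiv m).symm.injective hw
      subst this
      exact ⟨0, isTour_zero, by simp⟩
    | step a s _ ih =>
      intro v hw
      obtain ⟨k, hk, rfl⟩ := ih (arcSrc p a) (treeGraph_src hp a).symm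
      rw [treeGraph_tgt] at hw
      have : v = arcTgt p a := (finSuccEquiv m).symm.injective hw
      subst this
      exact ⟨_, hk.step hp a, (sum_weighted_add_single _ _).symm⟩
  exact key _ s h v rfl

/-- A walk is rebuilt from its end: one last step is removed so that the rest is again a tour, by
induction on the total number of passages. -/
theorem treeEmits_of_isTour (hp : IsParent p) {v : Option (Fin m)} {k : Fin m → ℕ}
    (h : IsTour p v k) : TreeEmits p hp t v (∑ i, t i * k i) := by
  induction hn : ∑ i, k i generalizing v k with
  | zero =>
    have hk : k = 0 := by
      funext i
      exact Finset.sum_eq_zero_iff.1 hn i (Finset.mem_univ i)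
    subst hk
    cases v with
    | none =>
      simp only [Pi.zero_apply, Nat.cast_zero, mul_zero, Finset.sum_const_zero]
      exact RootedGraph.Emits.start
    | some e => have := (h.1 e).2 (by simp [rootPath_some]); simp at this
  | succ n ih =>
    have key : ∀ (a : RootedGraph.Arc m) (k' : Fin m → ℕ), arcTgt p a = v →
        k' + Pi.single a.1 1 = k → IsTour p (arcSrc p a) k' →
        TreeEmits p hp t v (∑ i, t i * k i) := by
      rintro a k' rfl rfl hk'
      rw [sum_weighted_add_single]
      refine TreeEmits.step hp a (ih hk' ?_)
      simp [Finset.sum_add_distrib] at hn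
      exact hn
    have hsub : ∀ e, 0 < k e → (k - Pi.single e 1) + Pi.single e 1 = k := by
      intro e he
      funext i
      by_cases hi : i = e
      · subst hi; simp; omega
      · simp [hi]
    obtain ⟨h1, h2⟩ := h
    -- If a child edge `c` of `v` is used, its passage number is even and positive, and the walk can
    -- end by coming up along `c`; at least one passage of `c` remains. Otherwise it ends by coming
    -- down from the parent, and no used child is orphaned if that edge drops to zero.
    by_cases hc : ∃ c, p c = v ∧ 0 < k c
    · obtain ⟨c, rfl, hc⟩ := hc
      have hcv := notMem_rootPath hp c
      have heven : ¬ Odd (k c) := fun h => hcv ((h1 c).1 h)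
      have hk2 : 2 ≤ k c := by
        rcases Nat.lt_or_ge (k c) 2 with h | h
        · have : k c = 1 := by omega
          rw [this] at heven; simp at heven
        · exact h
      refine key (c, false) (k - Pi.single c 1) rfl (hsub c hc) ⟨fun f => ?_, fun e f hef he => ?_⟩
      · by_cases hf : f = c
        · subst hf
          simp only [arcSrc, Bool.false_eq_true, if_false, rootPath_some, Pi.sub_apply,
            Pi.single_eq_same, Finset.mem_insert_self, iff_true]
          rw [Nat.not_odd_iff_even] at heven
          exact Nat.Even.sub_odd hc heven odd_one
        · simpa [arcSrc, rootPath_some, hf] using h1 f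
      · have h3 : 0 < k e := by simp only [Pi.sub_apply] at he; omega
        have h4 := h2 e f hef h3
        by_cases hf : f = c
        · subst hf; simp; omega
        · simpa [hf] using h4
    · push Not at hc
      cases v with
      | none =>
        exfalso
        obtain ⟨rank, hr⟩ := hp
        -- At the root, no used edge starts there, so parent closure makes every edge unused,
        -- against the positive total.
        have hzero : ∀ e, k e = 0 := by
          intro e
          induction hn : rank e using Nat.strong_induction_on generalizing e with
          | _ n ih' =>
            subst hn
            cases hpe : p e with
            | none => simpa using hc e hpe
            | some g =>
              by_contra hne
              have := h2 e g hpe (Nat.pos_of_ne_zero hne)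
              rw [ih' _ (hr e g hpe) g rfl] at this
              simp at this
        simp [hzero] at hn
      | some e =>
        have hodd : Odd (k e) := (h1 e).2 (by simp [rootPath_some])
        refine key (e, true) (k - Pi.single e 1) rfl (hsub e hodd.pos)
          ⟨fun f => ?_, fun c f hcf hc' => ?_⟩
        · by_cases hf : f = e
          · subst hf
            simp only [arcSrc, if_true]
            simp only [Pi.sub_apply, Pi.single_eq_same, notMem_rootPath hp f, iff_false,
              Nat.not_odd_iff_even]
            exact Nat.Odd.sub_odd hodd odd_one
          · simpa [arcSrc, rootPath_some, hf] using h1 f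
        · have h3 : 0 < k c := by simp only [Pi.sub_apply] at hc'; omega
          have h4 := h2 c f hcf h3
          by_cases hf : f = e
          · subst hf
            have := hc c hcf
            omega
          · simpa [hf] using h4

theorem treeEmits_iff (hp : IsParent p) {v : Option (Fin m)} {s : ℝ} :
    TreeEmits p hp t v s ↔ ∃ k, IsTour p v k ∧ s = ∑ i, t i * k i := by
  constructor
  · exact exists_isTour_of_treeEmits hp
  · rintro ⟨k, hk, rfl⟩
    exact treeEmits_of_isTour hp hk

end Tree

theorem ncard_eq_sum_ncard_fiber {α β : Type*} [Fintype α] (P : Set (α × β)) (hP : P.Finite) :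
    P.ncard = ∑ a, {b | (a, b) ∈ P}.ncard := by
  have hfin : ∀ a, Finite {b | (a, b) ∈ P} := fun a =>
    (hP.preimage (Prod.mk_right_injective a).injOn).to_subtype
  have e : P ≃ Σ a, {b | (a, b) ∈ P} :=
    { toFun := fun x => ⟨x.1.1, x.1.2, x.2⟩
      invFun := fun x => ⟨(x.1, x.2.1), x.2.2⟩
      left_inv := fun _ => rfl
      right_inv := fun _ => rfl }
  rw [← Nat.card_coe_set_eq, Nat.card_congr e, Nat.card_sigma]
  rfl

/-! ### Finiteness of the point sets and passage to one-sided limits. -/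

section Emission

variable {m : ℕ} {t : Fin m → ℝ}

theorem RootedGraph.Emits.exists_eq_sum {Γ : RootedGraph m} {v : Fin Γ.n} {s : ℝ}
    (h : Γ.Emits t v s) : ∃ k : Fin m → ℕ, s = ∑ i, t i * k i := by
  induction h with
  | start => exact ⟨0, by simp⟩
  | step a s _ ih =>
    obtain ⟨k, rfl⟩ := ih
    exact ⟨_, (sum_weighted_add_single a.1 k).symm⟩

/-- The times up to `T` that occur as lengths of walks form a finite set. -/
theorem finite_weighted_values (ht : ∀ i, 0 < t i) (T : ℝ) :
    {s : ℝ | (∃ k : Fin m → ℕ, s = ∑ i, t i * k i) ∧ s ≤ T}.Finite := by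
  refine ((finite_weighted_le ht T).image fun k => ∑ i, t i * (k i : ℝ)).subset ?_
  rintro s ⟨⟨k, rfl⟩, hs⟩
  exact ⟨k, hs, rfl⟩

theorem finite_pointsAfter (Γ : RootedGraph m) (ht : ∀ i, 0 < t i) (T : ℝ) :
    (Γ.pointsAfter t T).Finite := by
  refine (Set.Finite.prod Set.finite_univ (finite_weighted_values ht T)).subset ?_
  rintro ⟨a, s⟩ ⟨h1, h2, _⟩
  exact ⟨trivial, h1.exists_eq_sum, h2⟩

theorem finite_pointsBefore (Γ : RootedGraph m) (ht : ∀ i, 0 < t i) (T : ℝ) :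
    (Γ.pointsBefore t T).Finite := by
  refine (Set.Finite.prod Set.finite_univ (finite_weighted_values ht T)).subset ?_
  rintro ⟨a, s⟩ ⟨h1, h2, _⟩
  exact ⟨trivial, h1.exists_eq_sum, h2.le⟩

/-- Immediately before time `T` the points are those present at all slightly earlier times. -/
theorem eventually_pointsAfter_eq_pointsBefore (Γ : RootedGraph m) (ht : ∀ i, 0 < t i) (T : ℝ) :
    ∀ᶠ S in 𝓝[<] T, Γ.pointsAfter t S = Γ.pointsBefore t T := by
  -- Only finitely many possible emission times precede `T`; once `S` has passed all of them,
  -- nothing happens between `S` and `T`.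
  set F := {s : ℝ | (∃ k : Fin m → ℕ, s = ∑ i, t i * k i) ∧ s ≤ T} \ {T} with hF
  have hfin : F.Finite := (finite_weighted_values ht T).sdiff
  have h1 : ∀ᶠ S in 𝓝[<] T, ∀ s ∈ F, s < S := by
    rw [hfin.eventually_all]
    intro s hs
    refine mem_nhdsWithin_of_mem_nhds (lt_mem_nhds (lt_of_le_of_ne hs.1.2 hs.2))
  filter_upwards [h1, self_mem_nhdsWithin] with S hS hST
  ext ⟨a, s⟩
  constructor
  · rintro ⟨h1, h2, h3⟩
    refine ⟨h1, h2.trans_lt hST, ?_⟩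
    by_contra hlt
    push Not at hlt
    have hem := RootedGraph.Emits.step a s h1
    exact lt_asymm h3 (hS _ ⟨⟨hem.exists_eq_sum, hlt.le⟩, hlt.ne⟩)
  · rintro ⟨h1, h2, h3⟩
    exact ⟨h1, (hS _ ⟨⟨h1.exists_eq_sum, h2.le⟩, h2.ne⟩).le, lt_of_lt_of_le hST h3⟩

/-- A strict comparison of the numbers of points immediately after every large time carries over
to `numPoints`. -/
theorem eventually_numPoints_lt {Γ Γ' : RootedGraph m} (ht : ∀ i, 0 < t i)
    (h : ∀ᶠ T in atTop, (Γ'.pointsAfter t T).ncard < (Γ.pointsAfter t T).ncard) :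
    ∀ᶠ T in atTop, Γ'.numPoints t T < Γ.numPoints t T := by
  obtain ⟨T₀, hT₀⟩ := eventually_atTop.1 h
  filter_upwards [eventually_gt_atTop T₀] with T hT
  have h1 := hT₀ T hT.le
  have h2 : (Γ'.pointsBefore t T).ncard < (Γ.pointsBefore t T).ncard := by
    obtain ⟨S, hS, hS', hST⟩ := ((eventually_pointsAfter_eq_pointsBefore Γ ht T).and
      ((eventually_pointsAfter_eq_pointsBefore Γ' ht T).and
        (mem_nhdsWithin_of_mem_nhds (lt_mem_nhds hT)))).exists
    rw [← hS, ← hS']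
    exact hT₀ S (le_of_lt hST)
  unfold RootedGraph.numPoints
  have h1' : ((Γ'.pointsAfter t T).ncard : ℝ) < (Γ.pointsAfter t T).ncard := Nat.cast_lt.2 h1
  have h2' : ((Γ'.pointsBefore t T).ncard : ℝ) < (Γ.pointsBefore t T).ncard := Nat.cast_lt.2 h2
  linarith

end Emission

/-! ### Exact number of points on a tree. -/

section TreeCount

variable {m : ℕ} {p : Fin m → Option (Fin m)} {t : Fin m → ℝ}

/-- The passage vectors of walks from the root to `v` of length at most `T`. -/
def tourSet (p : Fin m → Option (Fin m)) (t : Fin m → ℝ) (v : Option (Fin m)) (T : ℝ) :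
    Set (Fin m → ℕ) :=
  {k | IsTour p v k ∧ ∑ i, t i * k i ≤ T}

theorem finite_tourSet (ht : ∀ i, 0 < t i) (v : Option (Fin m)) (T : ℝ) :
    (tourSet p t v T).Finite :=
  (finite_weighted_le ht T).subset fun _ hk => hk.2

theorem sum_mul_natCast_injective (hli : LinearIndependent ℚ t) :
    Function.Injective fun k : Fin m → ℕ => ∑ i, t i * (k i : ℝ) := by
  intro k l hkl
  have h1 := Fintype.linearIndependent_iff.1 hli (fun i => (k i : ℚ) - l i) (by
    simp only at hkl
    simp only [Rat.smul_def, Rat.cast_sub, Rat.cast_natCast, sub_mul, Finset.sum_sub_distrib]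
    rw [sub_eq_zero]
    simpa only [mul_comm] using hkl)
  funext i
  have := h1 i
  rw [sub_eq_zero] at this
  exact_mod_cast this

/-- A point on an arc `a` entered it during `(T - t a.1, T]`. By independence distinct tours have
distinct lengths, so no merging makes the number of entering times smaller than the number of tours.
-/
theorem ncard_pointsAfter_treeGraph (hp : IsParent p) (ht : ∀ i, 0 < t i)
    (hli : LinearIndependent ℚ t) (T : ℝ) :
    (((treeGraph p hp).pointsAfter t T).ncard : ℝ) = ∑ a : RootedGraph.Arc m,
      (((tourSet p t (arcSrc p a) T).ncard : ℝ) -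
        (tourSet p t (arcSrc p a) (T - t a.1)).ncard) := by
  rw [ncard_eq_sum_ncard_fiber _ (finite_pointsAfter _ ht T), Nat.cast_sum]
  refine Finset.sum_congr rfl fun a _ => ?_
  have hsub : tourSet p t (arcSrc p a) (T - t a.1) ⊆ tourSet p t (arcSrc p a) T :=
    fun k hk => ⟨hk.1, hk.2.trans (by linarith [ht a.1])⟩
  have himg : {s | (a, s) ∈ (treeGraph p hp).pointsAfter t T} =
      (fun k : Fin m → ℕ => ∑ i, t i * (k i : ℝ)) ''
        (tourSet p t (arcSrc p a) T \ tourSet p t (arcSrc p a) (T - t a.1)) := by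
    ext s
    constructor
    · rintro ⟨h1, h2, h3⟩
      simp only at h1 h2 h3
      rw [treeGraph_src] at h1
      obtain ⟨k, hk, rfl⟩ := (treeEmits_iff hp).1 h1
      exact ⟨k, ⟨⟨hk, h2⟩, fun h => absurd h.2 (by linarith)⟩, rfl⟩
    · rintro ⟨k, ⟨⟨hk, h2⟩, h3⟩, rfl⟩
      refine ⟨?_, h2, ?_⟩
      · rw [treeGraph_src]
        exact (treeEmits_iff hp).2 ⟨k, hk, rfl⟩
      · by_contra hlt
        push Not at hlt
        exact h3 ⟨hk, by simp only at hlt; linarith⟩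
  rw [himg, Set.ncard_image_of_injective _ (sum_mul_natCast_injective hli),
    Set.ncard_sdiff hsub (finite_tourSet ht _ _),
    Nat.cast_sub (Set.ncard_le_ncard hsub (finite_tourSet ht _ _))]

open Classical in
/-- The parent-closed sets of edges that contain the path to `v`. -/
noncomputable def supports (p : Fin m → Option (Fin m)) (v : Option (Fin m)) :
    Finset (Finset (Fin m)) :=
  Finset.univ.filter fun S => ParentClosed p S ∧ rootPath p v ⊆ S

open Classical in
-- Writing the passages as `2 * k f - 1` on the path and `2 * k f` off it removes the parity
-- condition. What remains is that the support of `k` is parent-closed and contains the path.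
theorem ncard_tourSet (ht : ∀ i, 0 < t i) (v : Option (Fin m)) (T : ℝ) :
    ((tourSet p t v T).ncard : ℝ) = ∑ S ∈ supports p v,
      latticeCount (fun i => 2 * t i) S (T + ∑ f ∈ rootPath p v, t f) := by
  have ht2 : ∀ i, 0 < 2 * t i := fun i => by linarith [ht i]
  set a : Fin m → ℝ := fun i => 2 * t i
  set X := T + ∑ f ∈ rootPath p v, t f with hX
  -- The truncated subtraction is exact on the vectors used, where `k f` is positive on the path.
  let b : (Fin m → ℕ) → Fin m → ℕ := fun k f => 2 * k f - if f ∈ rootPath p v then 1 else 0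
  have hunion : tourSet p t v T = b '' ⋃ S ∈ supports p v, latticeSet a S X := by
    have hval : ∀ k : Fin m → ℕ, (∀ f ∈ rootPath p v, 1 ≤ k f) →
        ∑ i, t i * (b k i : ℝ) = ∑ i, a i * k i - ∑ f ∈ rootPath p v, t f := by
      intro k hk
      have h1 : ∑ f ∈ rootPath p v, t f = ∑ f, if f ∈ rootPath p v then t f else 0 := by
        rw [← Finset.sum_filter]; congr 1; ext; simp
      rw [h1, ← Finset.sum_sub_distrib]
      refine Finset.sum_congr rfl fun i _ => ?_
      by_cases hi : i ∈ rootPath p v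
      · have := hk i hi
        simp only [b, a, hi, if_true]
        rw [Nat.cast_sub (by omega)]
        push_cast; ring
      · simp only [b, a, hi, if_false, Nat.sub_zero]
        push_cast; ring
    ext n
    constructor
    · rintro ⟨⟨h1, h2⟩, h3⟩
      have hb : b (fun f => (n f + 1) / 2) = n := by
        funext f
        by_cases hf : f ∈ rootPath p v
        · obtain ⟨j, hj⟩ := (h1 f).2 hf
          simp only [b, hf, if_true]; omega
        · have : ¬ Odd (n f) := fun h => hf ((h1 f).1 h)
          rw [Nat.not_odd_iff_even] at this
          obtain ⟨j, hj⟩ := this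
          simp only [b, hf, if_false]; omega
      have hpos : ∀ f ∈ rootPath p v, 0 < n f := fun f hf => ((h1 f).2 hf).pos
      refine ⟨fun f => (n f + 1) / 2, ?_, hb⟩
      simp only [Set.mem_iUnion]
      refine ⟨Finset.univ.filter fun f => 0 < n f, ?_, fun i => ?_, ?_⟩
      · simp only [supports, Finset.mem_filter, Finset.mem_univ, true_and]
        refine ⟨fun e f hef he => ?_, fun f hf => ?_⟩
        · simp only [Finset.mem_filter, Finset.mem_univ, true_and] at he ⊢
          exact h2 e f hef he
        · simpa using hpos f hf
      · simp only [Finset.mem_filter, Finset.mem_univ, true_and]; omega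
      · have := hval (fun f => (n f + 1) / 2) (fun f hf => by have := hpos f hf; omega)
        rw [hb] at this
        linarith
    · rintro ⟨k, hk, rfl⟩
      simp only [Set.mem_iUnion] at hk
      obtain ⟨S, hS, hk1, hk2⟩ := hk
      simp only [supports, Finset.mem_filter, Finset.mem_univ, true_and] at hS
      have hpos : ∀ f ∈ rootPath p v, 1 ≤ k f := fun f hf => (hk1 f).2 (hS.2 hf)
      refine ⟨⟨fun f => ?_, fun e f hef he => ?_⟩, ?_⟩
      · by_cases hf : f ∈ rootPath p v
        · have := hpos f hf
          simp only [b, hf, if_true, iff_true]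
          exact ⟨k f - 1, by omega⟩
        · simp [b, hf]
      · have h1 : 1 ≤ k e := by
          simp only [b] at he; omega
        have h2 : 1 ≤ k f := (hk1 f).2 (hS.1 e f hef ((hk1 e).1 h1))
        simp only [b]; split_ifs <;> omega
      · rw [hval k hpos]; linarith
  have hinj : Set.InjOn b (⋃ S ∈ supports p v, latticeSet a S X) := by
    intro k hk l hl hkl
    simp only [Set.mem_iUnion] at hk hl
    obtain ⟨S, hS, hk1, _⟩ := hk
    obtain ⟨S', hS', hl1, _⟩ := hl
    simp only [supports, Finset.mem_filter, Finset.mem_univ, true_and] at hS hS'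
    funext f
    have h := congrFun hkl f
    simp only [b] at h
    by_cases hf : f ∈ rootPath p v
    · have h1 := (hk1 f).2 (hS.2 hf)
      have h2 := (hl1 f).2 (hS'.2 hf)
      simp only [hf, if_true] at h; omega
    · simp only [hf, if_false] at h; omega
  rw [hunion, hinj.ncard_image]
  have hdisj : (supports p v : Set (Finset (Fin m))).PairwiseDisjoint
      fun S => latticeSet a S X := by
    intro S _ S' _ hne
    rw [Function.onFun, Set.disjoint_left]
    intro k h1 h2
    refine hne (Finset.ext fun i => ?_)
    rw [← h1.1 i, h2.1 i]
  have : (⋃ S ∈ supports p v, latticeSet a S X).ncard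
      = ∑ S ∈ supports p v, (latticeSet a S X).ncard := by
    have hfin : ∀ S, (latticeSet a S X).Finite := fun S => latticeSet_finite ht2 S X
    have h1 : (⋃ S ∈ supports p v, latticeSet a S X) =
        ((supports p v).biUnion fun S => (hfin S).toFinset : Finset (Fin m → ℕ)) := by
      ext k; simp
    rw [h1, Set.ncard_coe_finset, Finset.card_biUnion]
    · refine Finset.sum_congr rfl fun S _ => ?_
      rw [Set.ncard_eq_toFinset_card _ (hfin S)]
    · intro S hS S' hS' hne
      have := hdisj hS hS' hne
      simpa [Function.onFun, Set.disjoint_left, Finset.disjoint_left] using this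
  rw [this, Nat.cast_sum]
  rfl

end TreeCount

/-! ### The second coefficient of the number of points on a tree. -/

section TreeAsymptotics

variable {n m : ℕ}

open Classical in
/-- The edges that are not the parent of any edge. -/
noncomputable def leafEdges (p : Fin m → Option (Fin m)) : Finset (Fin m) :=
  Finset.univ.filter fun f => ∀ c, p c ≠ some f

theorem mem_leafEdges {p : Fin m → Option (Fin m)} {f : Fin m} :
    f ∈ leafEdges p ↔ ∀ c, p c ≠ some f := by
  simp [leafEdges]

open Classical in
/-- The part of the second coefficient of the number of points that depends on the tree. -/
noncomputable def growthCost (t : Fin m → ℝ) (p : Fin m → Option (Fin m)) : ℝ :=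
  ∑ e, t e * ∑ f ∈ rootPath p (p e), t f +
    ∑ e, ∑ f ∈ leafEdges p, if f = e then t e * t e else 2 * (t e * t f)

theorem exists_child_of_mem_rootPath {p : Fin m → Option (Fin m)} (hp : IsParent p)
    {e f : Fin m} (h : f ∈ rootPath p (p e)) : ∃ c, p c = some f := by
  obtain ⟨rank, hr⟩ := hp
  induction hn : rank e using Nat.strong_induction_on generalizing e with
  | _ n ih =>
    subst hn
    cases hpe : p e with
    | none => rw [hpe, rootPath_none] at h; simp at h
    | some g =>
      rw [hpe, rootPath_some, Finset.mem_insert] at h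
      rcases h with rfl | h
      · exact ⟨e, hpe⟩
      · exact ih _ (hr e g hpe) h rfl

/-- Removing an edge preserves closure exactly when it has no child. Such an edge never lies on the
path to the near end of `e`, so the answer is independent of `e`. -/
theorem univ_erase_mem_supports {p : Fin m → Option (Fin m)} (hp : IsParent p) {e f : Fin m} :
    Finset.univ.erase f ∈ supports p (p e) ↔ f ∈ leafEdges p := by
  simp only [supports, Finset.mem_filter, Finset.mem_univ, true_and, mem_leafEdges]
  constructor
  · rintro ⟨h1, _⟩ c hc
    have hcf : c ≠ f := by
      rintro rfl
      obtain ⟨rank, hr⟩ := hp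
      exact lt_irrefl _ (hr c c hc)
    have := h1 c f hc (by simp [hcf])
    simp at this
  · intro h
    refine ⟨fun c g hcg _ => ?_, fun g hg => ?_⟩
    · simp only [Finset.mem_erase, Finset.mem_univ, and_true]
      rintro rfl
      exact h c hcg
    · simp only [Finset.mem_erase, Finset.mem_univ, and_true]
      rintro rfl
      obtain ⟨c, hc⟩ := exists_child_of_mem_rootPath hp hg
      exact h c hc

theorem mem_supports_some {p : Fin m → Option (Fin m)} {e : Fin m}
    {S : Finset (Fin m)} : S ∈ supports p (some e) ↔ S ∈ supports p (p e) ∧ e ∈ S := by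
  simp only [supports, Finset.mem_filter, Finset.mem_univ, true_and, rootPath_some]
  constructor
  · rintro ⟨h1, h2⟩
    rw [Finset.insert_subset_iff] at h2
    exact ⟨⟨h1, h2.2⟩, h2.1⟩
  · rintro ⟨⟨h1, h2⟩, h3⟩
    exact ⟨h1, Finset.insert_subset h3 h2⟩

theorem irrational_div_of_linearIndependent {t : Fin m → ℝ} (hli : LinearIndependent ℚ t)
    {e f : Fin m} (hef : e ≠ f) : Irrational (2 * t e / (2 * t f)) := by
  have hf : t f ≠ 0 := hli.ne_zero f
  rw [mul_div_mul_left _ _ two_ne_zero]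
  rintro ⟨q, hq⟩
  have h1 := Fintype.linearIndependent_iff.1 hli
    (fun i => if i = e then 1 else if i = f then -q else 0) (by
      rw [Finset.sum_eq_add e f hef]
      · simp only [if_true, hef.symm, if_false, one_smul, Rat.smul_def, Rat.cast_neg, hq]
        field_simp
        ring
      · rintro c _ ⟨h1, h2⟩
        simp [h1, h2]
      · simp
      · simp)
  have := h1 e
  simp at this

/-- The contribution of the edge `e` and the support `S` to the number of points on a tree, where
`u` is the distance from the root to the near end of `e`. -/
noncomputable def edgeTerm (t : Fin m → ℝ) (u : ℝ) (e : Fin m) (S : Finset (Fin m)) (T : ℝ) : ℝ :=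
  if e ∈ S then latticeCount (fun i => 2 * t i) (S.erase e) (T + (u - t e))
  else latticeCount (fun i => 2 * t i) S (T + u) -
    latticeCount (fun i => 2 * t i) S (T + (u - t e))

/-- For a support containing `e`, the two directions of `e` give adjacent windows of length `t e`.
Together they have length `2 * t e`, the weight of `e`, so the recursion evaluates their sum
exactly. -/
theorem ncard_pointsAfter_eq_sum_edgeTerm {p : Fin m → Option (Fin m)} (hp : IsParent p)
    {t : Fin m → ℝ} (ht : ∀ i, 0 < t i) (hli : LinearIndependent ℚ t) (T : ℝ) :
    (((treeGraph p hp).pointsAfter t T).ncard : ℝ) = ∑ e, ∑ S ∈ supports p (p e),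
      edgeTerm t (∑ f ∈ rootPath p (p e), t f) e S T := by
  have ht2 : ∀ i, 0 < 2 * t i := fun i => by linarith [ht i]
  rw [ncard_pointsAfter_treeGraph hp ht hli, Fintype.sum_prod_type]
  refine Finset.sum_congr rfl fun e _ => ?_
  rw [Fintype.sum_bool]
  simp only [arcSrc, if_true, Bool.false_eq_true, if_false]
  rw [ncard_tourSet ht, ncard_tourSet ht, ncard_tourSet ht, ncard_tourSet ht,
    rootPath_some, Finset.sum_insert (notMem_rootPath hp e)]
  set u := ∑ f ∈ rootPath p (p e), t f
  have hsupp : supports p (some e) = (supports p (p e)).filter fun S => e ∈ S := by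
    ext S
    rw [mem_supports_some, Finset.mem_filter]
  rw [hsupp, Finset.sum_filter, Finset.sum_filter, ← Finset.sum_sub_distrib,
    ← Finset.sum_sub_distrib, ← Finset.sum_add_distrib]
  refine Finset.sum_congr rfl fun S _ => ?_
  unfold edgeTerm
  by_cases heS : e ∈ S
  · simp only [heS, if_true]
    have h1 := latticeCount_eq_add ht2 heS (T + (t e + u))
    rw [show T + (t e + u) - 2 * t e = T + (u - t e) by ring] at h1
    rw [h1, show T - t e + u = T + (u - t e) by ring, show T - t e + (t e + u) = T + u by ring]
    ring
  · simp only [heS, if_false]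
    rw [show T - t e + u = T + (u - t e) by ring]
    ring

/-- The common normalizing factor of all second coefficients. -/
noncomputable def secondFactor (n : ℕ) (t : Fin (n + 2) → ℝ) : ℝ :=
  1 / (n.factorial * ∏ i, 2 * t i)

theorem secondFactor_pos {t : Fin (n + 2) → ℝ} (ht : ∀ i, 0 < t i) : 0 < secondFactor n t := by
  have : 0 < ∏ i, 2 * t i := Finset.prod_pos fun i _ => by linarith [ht i]
  unfold secondFactor
  positivity

theorem one_div_prod_erase {t : Fin (n + 2) → ℝ} (ht : ∀ i, 0 < t i) {S : Finset (Fin (n + 2))}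
    {e : Fin (n + 2)} (he : e ∈ S) :
    1 / ((n.factorial : ℝ) * ∏ i ∈ S.erase e, 2 * t i) =
      2 * t e * (1 / ((n.factorial : ℝ) * ∏ i ∈ S, 2 * t i)) := by
  rw [← Finset.mul_prod_erase S (fun i => 2 * t i) he]
  have := (ht e).ne'
  have : ∏ i ∈ S.erase e, 2 * t i ≠ 0 :=
    (Finset.prod_pos fun i _ => by linarith [ht i]).ne'
  field_simp

theorem tendsto_window_erase {t : Fin (n + 2) → ℝ} (hn : 1 ≤ n) (ht : ∀ i, 0 < t i)
    (hli : LinearIndependent ℚ t) (e : Fin (n + 2)) (h : ℝ) :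
    Tendsto (fun T => (latticeCount (fun i => 2 * t i) (Finset.univ.erase e) (T + h) -
      latticeCount (fun i => 2 * t i) (Finset.univ.erase e) T) / T ^ n) atTop
      (𝓝 (secondFactor n t * (2 * t e * h))) := by
  have ht2 : ∀ i, 0 < 2 * t i := fun i => by linarith [ht i]
  have hcard : (Finset.univ.erase e).card = n + 1 := by simp
  obtain ⟨i, hi, j, hj, hij⟩ := Finset.one_lt_card.1 (by omega : 1 < (Finset.univ.erase e).card)
  have h1 := tendsto_latticeCount_window ht2 hcard hi hj
    (irrational_div_of_linearIndependent hli hij) h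
  rw [one_div_prod_erase ht (Finset.mem_univ e)] at h1
  convert h1 using 2
  unfold secondFactor
  ring

theorem tendsto_edgeTerm_erase {t : Fin (n + 2) → ℝ} (hn : 1 ≤ n) (ht : ∀ i, 0 < t i)
    (hli : LinearIndependent ℚ t) (u : ℝ) (e f : Fin (n + 2)) :
    Tendsto (fun T => edgeTerm t u e (Finset.univ.erase f) T / T ^ n) atTop
      (𝓝 (secondFactor n t * if f = e then 2 * (t e * t e) else 4 * (t e * t f))) := by
  have ht2 : ∀ i, 0 < 2 * t i := fun i => by linarith [ht i]
  by_cases hfe : f = e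
  · subst hfe
    have h1 := tendsto_shift_div_pow (tendsto_window_erase hn ht hli f (t f)) (u - t f)
    simp only [if_true]
    convert h1 using 2
    · simp only [edgeTerm, Finset.notMem_erase, if_false]
      congr 3
      ring
    · ring
  · have he : e ∈ Finset.univ.erase f := by simp [Ne.symm hfe]
    have hcard : ((Finset.univ.erase f).erase e).card = n := by
      rw [Finset.card_erase_of_mem he]; simp
    have h1 := tendsto_shift_div_pow
      (tendsto_latticeCount ht2 ((Finset.univ.erase f).erase e)) (u - t e)
    rw [hcard, one_div_prod_erase ht he, one_div_prod_erase ht (Finset.mem_univ f)] at h1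
    simp only [edgeTerm, he, if_true, hfe, if_false]
    convert h1 using 2
    unfold secondFactor
    ring

/-- If `e ∈ S`, erasing it leaves fewer than `n` dimensions; otherwise the leading terms of the two
shifted counts cancel. -/
theorem tendsto_edgeTerm_of_card_le {t : Fin (n + 2) → ℝ} (ht : ∀ i, 0 < t i) (u : ℝ)
    (e : Fin (n + 2)) {S : Finset (Fin (n + 2))} (hS : S.card ≤ n) :
    Tendsto (fun T => edgeTerm t u e S T / T ^ n) atTop (𝓝 0) := by
  have ht2 : ∀ i, 0 < 2 * t i := fun i => by linarith [ht i]
  unfold edgeTerm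
  by_cases he : e ∈ S
  · simp only [he, if_true]
    have := Finset.card_erase_lt_of_mem he
    exact tendsto_div_pow_of_lt (by omega)
      (tendsto_shift_div_pow (tendsto_latticeCount ht2 (S.erase e)) (u - t e))
  · simp only [he, if_false]
    have h1 := tendsto_shift_div_pow (tendsto_latticeCount ht2 S) u
    have h2 := tendsto_shift_div_pow (tendsto_latticeCount ht2 S) (u - t e)
    have h3 := h1.sub h2
    rw [sub_self] at h3
    simp only [← sub_div] at h3
    rcases hS.lt_or_eq with hlt | heq
    · exact tendsto_div_pow_of_lt hlt h3
    · rwa [heq] at h3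

open Classical in
-- The full support differs from the tree-independent reference count by the shift `u - t e`, which
-- is visible at order `T ^ n`. Supports missing one leaf edge also contribute at that order, and
-- all smaller ones are negligible.
theorem tendsto_sum_edgeTerm {p : Fin (n + 2) → Option (Fin (n + 2))} (hp : IsParent p)
    {t : Fin (n + 2) → ℝ} (hn : 1 ≤ n) (ht : ∀ i, 0 < t i) (hli : LinearIndependent ℚ t)
    (u : ℝ) (e : Fin (n + 2)) :
    Tendsto (fun T => (∑ S ∈ supports p (p e), edgeTerm t u e S T -
      latticeCount (fun i => 2 * t i) (Finset.univ.erase e) T) / T ^ n) atTop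
      (𝓝 (secondFactor n t * (2 * t e * (u - t e) +
        ∑ f ∈ leafEdges p, if f = e then 2 * (t e * t e) else 4 * (t e * t f)))) := by
  have huniv : Finset.univ ∈ supports p (p e) := by
    simp [supports, parentClosed_univ]
  set R := (supports p (p e)).erase Finset.univ with hR
  have hfilter : R.filter (fun S => ¬ S.card ≤ n) =
      (leafEdges p).image fun f => Finset.univ.erase f := by
    ext S
    simp only [hR, Finset.mem_filter, Finset.mem_erase, Finset.mem_image, not_le]
    constructor
    · rintro ⟨⟨h1, h2⟩, h3⟩
      obtain ⟨f, hf⟩ : ∃ f, f ∉ S := by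
        by_contra hcon
        push Not at hcon
        exact h1 (Finset.eq_univ_iff_forall.2 hcon)
      have hSf : Finset.univ.erase f = S := by
        symm
        refine Finset.eq_of_subset_of_card_le (fun x hx => ?_) (by simp; omega)
        simp only [Finset.mem_erase, Finset.mem_univ, and_true]
        rintro rfl
        exact hf hx
      refine ⟨f, ?_, hSf⟩
      rw [← hSf] at h2
      exact (univ_erase_mem_supports hp).1 h2
    · rintro ⟨f, hf, rfl⟩
      refine ⟨⟨?_, (univ_erase_mem_supports hp).2 hf⟩, by simp⟩
      intro h
      have := Finset.mem_univ f
      rw [← h] at this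
      simp at this
  have hinj : Set.InjOn (fun f : Fin (n + 2) => Finset.univ.erase f) (leafEdges p) := by
    intro f _ g _ hfg
    by_contra hne
    have : f ∈ Finset.univ.erase g := by simp [hne]
    simp only at hfg
    rw [← hfg] at this
    simp at this
  have h1 : Tendsto (fun T => ∑ S ∈ R.filter (fun S => S.card ≤ n), edgeTerm t u e S T / T ^ n)
      atTop (𝓝 (∑ S ∈ R.filter (fun S => S.card ≤ n), 0)) :=
    tendsto_finsetSum _ fun S hS =>
      tendsto_edgeTerm_of_card_le ht u e (Finset.mem_filter.1 hS).2
  rw [Finset.sum_const_zero] at h1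
  have h2 : Tendsto (fun T => ∑ f ∈ leafEdges p, edgeTerm t u e (Finset.univ.erase f) T / T ^ n)
      atTop (𝓝 (∑ f ∈ leafEdges p, secondFactor n t *
        if f = e then 2 * (t e * t e) else 4 * (t e * t f))) :=
    tendsto_finsetSum _ fun f _ => tendsto_edgeTerm_erase hn ht hli u e f
  have h3 := ((tendsto_window_erase hn ht hli e (u - t e)).add h1).add h2
  rw [add_zero, ← Finset.mul_sum, ← mul_add] at h3
  refine h3.congr fun T => ?_
  rw [← Finset.add_sum_erase _ _ huniv, ← hR, ← Finset.sum_filter_add_sum_filter_not R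
    (fun S => S.card ≤ n), hfilter, Finset.sum_image hinj]
  have hterm : edgeTerm t u e Finset.univ T =
      latticeCount (fun i => 2 * t i) (Finset.univ.erase e) (T + (u - t e)) := by
    simp [edgeTerm]
  rw [hterm, ← Finset.sum_div, ← Finset.sum_div, ← add_div, ← add_div]
  congr 1
  ring

/-- The second term of the number of points on a tree. The subtracted sum is the same for all
trees with the same edges. -/
theorem tendsto_ncard_pointsAfter {p : Fin (n + 2) → Option (Fin (n + 2))} (hp : IsParent p)
    {t : Fin (n + 2) → ℝ} (hn : 1 ≤ n) (ht : ∀ i, 0 < t i) (hli : LinearIndependent ℚ t) :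
    Tendsto (fun T => (((treeGraph p hp).pointsAfter t T).ncard -
      ∑ e, latticeCount (fun i => 2 * t i) (Finset.univ.erase e) T) / T ^ n) atTop
      (𝓝 (2 * secondFactor n t * (growthCost t p - ∑ e, t e * t e))) := by
  classical
  have h1 : Tendsto (fun T => ∑ e, (∑ S ∈ supports p (p e),
      edgeTerm t (∑ f ∈ rootPath p (p e), t f) e S T -
      latticeCount (fun i => 2 * t i) (Finset.univ.erase e) T) / T ^ n) atTop (𝓝 (∑ e, _)) :=
    tendsto_finsetSum _ fun e _ =>
      tendsto_sum_edgeTerm hp hn ht hli (∑ f ∈ rootPath p (p e), t f) e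
  convert h1 using 2 with T
  · rw [ncard_pointsAfter_eq_sum_edgeTerm hp ht hli, ← Finset.sum_sub_distrib, Finset.sum_div]
  · rw [growthCost, ← Finset.mul_sum, mul_assoc, mul_left_comm, ← Finset.sum_add_distrib,
      ← Finset.sum_sub_distrib, Finset.mul_sum]
    congr 1
    refine Finset.sum_congr rfl fun e _ => ?_
    have : (∑ f ∈ leafEdges p, if f = e then 2 * (t e * t e) else 4 * (t e * t f)) =
        2 * ∑ f ∈ leafEdges p, if f = e then t e * t e else 2 * (t e * t f) := by
      rw [Finset.mul_sum]
      refine Finset.sum_congr rfl fun f _ => ?_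
      split_ifs <;> ring
    rw [this]
    ring

theorem eventually_numPoints_lt_of_growthCost_lt {p q : Fin (n + 2) → Option (Fin (n + 2))}
    (hp : IsParent p) (hq : IsParent q) {t : Fin (n + 2) → ℝ} (hn : 1 ≤ n) (ht : ∀ i, 0 < t i)
    (hli : LinearIndependent ℚ t) (h : growthCost t q < growthCost t p) :
    ∀ᶠ T in atTop, (treeGraph q hq).numPoints t T < (treeGraph p hp).numPoints t T := by
  refine eventually_numPoints_lt ht ?_
  have hlt : 2 * secondFactor n t * (growthCost t q - ∑ e, t e * t e) <
      2 * secondFactor n t * (growthCost t p - ∑ e, t e * t e) := by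
    have := secondFactor_pos ht
    gcongr
  filter_upwards [(tendsto_ncard_pointsAfter hq hn ht hli).eventually_lt
    (tendsto_ncard_pointsAfter hp hn ht hli) hlt, eventually_gt_atTop 0] with T hT hT0
  rw [div_lt_div_iff_of_pos_right (by positivity)] at hT
  have := (sub_lt_sub_iff_right _).1 hT
  exact_mod_cast this

end TreeAsymptotics

/-! ### Reduction from graphs to trees. -/

section Unfolding

variable {m : ℕ}

theorem RootedGraph.exists_dist (Γ : RootedGraph m) : ∃ dist : Fin Γ.n → ℕ, ∀ v, v ≠ Γ.root →
    ∃ u e, (Γ.ends e = (u, v) ∨ Γ.ends e = (v, u)) ∧ dist u < dist v := by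
  classical
  let step : Set (Fin Γ.n) → Set (Fin Γ.n) := fun A =>
    A ∪ {w | ∃ u ∈ A, ∃ e, Γ.ends e = (u, w) ∨ Γ.ends e = (w, u)}
  have hreach : ∀ v, ∃ j : ℕ, v ∈ step^[j] {Γ.root} := by
    intro v
    induction Γ.connected v with
    | refl => exact ⟨0, rfl⟩
    | tail _ h ih =>
      obtain ⟨j, hj⟩ := ih
      refine ⟨j + 1, ?_⟩
      rw [Function.iterate_succ_apply']
      exact Or.inr ⟨_, hj, h⟩
  refine ⟨fun v => Nat.find (hreach v), fun v hv => ?_⟩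
  obtain ⟨k, hk⟩ : ∃ k, Nat.find (hreach v) = k + 1 := by
    refine Nat.exists_eq_succ_of_ne_zero fun h0 => hv ?_
    have := Nat.find_spec (hreach v)
    rw [h0] at this
    exact this
  have h1 := Nat.find_spec (hreach v)
  rw [hk, Function.iterate_succ_apply'] at h1
  rcases h1 with h1 | ⟨u, hu, e, he⟩
  · have := Nat.find_min' (hreach v) h1
    omega
  · refine ⟨u, e, he, ?_⟩
    have := Nat.find_min' (hreach u) hu
    simp only
    omega

/-- Every connected rooted graph is the image of a tree built from the same edges. -/
theorem RootedGraph.exists_unfolding (Γ : RootedGraph m) :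
    ∃ p : Fin m → Option (Fin m), IsParent p ∧ ∃ (φ : Option (Fin m) → Fin Γ.n)
      (σ : Arc m → Arc m), Function.Injective σ ∧ (∀ a, (σ a).1 = a.1) ∧ φ none = Γ.root ∧
      ∀ a, Γ.src (σ a) = φ (arcSrc p a) ∧ Γ.tgt (σ a) = φ (arcTgt p a) := by
  classical
  obtain ⟨dist, hdist⟩ := Γ.exists_dist
  let near : Fin m → Fin Γ.n := fun e =>
    if dist (Γ.ends e).1 ≤ dist (Γ.ends e).2 then (Γ.ends e).1 else (Γ.ends e).2
  let far : Fin m → Fin Γ.n := fun e =>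
    if dist (Γ.ends e).1 ≤ dist (Γ.ends e).2 then (Γ.ends e).2 else (Γ.ends e).1
  have hnf : ∀ v, v ≠ Γ.root → ∃ e, far e = v ∧ dist (near e) < dist v := by
    intro v hv
    obtain ⟨u, e, he, huv⟩ := hdist v hv
    refine ⟨e, ?_⟩
    rcases he with he | he
    · simp [near, far, he, huv.le, huv]
    · simp [near, far, he, huv, huv.not_ge]
  -- `up v` is the one edge that represents `v` in the tree. Edges ending at `v` that were not
  -- chosen acquire no children, and distance from the root serves as the rank.
  choose up hup using hnf
  let p : Fin m → Option (Fin m) := fun e =>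
    if h : near e = Γ.root then none else some (up (near e) h)
  let φ : Option (Fin m) → Fin Γ.n := fun v => v.elim Γ.root far
  have hφ : ∀ e, φ (p e) = near e := by
    intro e
    by_cases h : near e = Γ.root
    · simp [φ, p, h]
    · simp [φ, p, h, (hup _ h).1]
  refine ⟨p, ⟨fun e => dist (near e), fun e f hef => ?_⟩, φ,
    fun a => (a.1, if dist (Γ.ends a.1).1 ≤ dist (Γ.ends a.1).2 then a.2 else !a.2),
    ?_, fun _ => rfl, rfl, ?_⟩
  · by_cases h : near e = Γ.root
    · simp [p, h] at hef
    · simp only [p, h, dif_neg, not_false_eq_true, Option.some.injEq] at hef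
      subst hef
      exact (hup _ h).2
  · rintro ⟨e, b⟩ ⟨e', b'⟩ h
    simp only [Prod.mk.injEq] at h
    obtain ⟨rfl, h⟩ := h
    split_ifs at h
    · rw [h]
    · rw [Bool.not_inj h]
  · rintro ⟨e, b⟩
    have h1 := hφ e
    have h2 : φ (some e) = far e := rfl
    cases b <;> simp only [arcSrc, arcTgt, if_true, Bool.false_eq_true, if_false, h1, h2,
      RootedGraph.src, RootedGraph.tgt, near, far] <;> split_ifs <;> simp_all

variable {t : Fin m → ℝ}

theorem RootedGraph.Emits.of_unfolding {Γ : RootedGraph m} {p : Fin m → Option (Fin m)}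
    (hp : IsParent p) {φ : Option (Fin m) → Fin Γ.n} {σ : Arc m → Arc m}
    (hσ : ∀ a, (σ a).1 = a.1) (hroot : φ none = Γ.root)
    (harc : ∀ a, Γ.src (σ a) = φ (arcSrc p a) ∧ Γ.tgt (σ a) = φ (arcTgt p a))
    {w : Fin (m + 1)} {s : ℝ} (h : (treeGraph p hp).Emits t w s) :
    Γ.Emits t (φ (finSuccEquiv m w)) s := by
  have key : ∀ (w : Fin (treeGraph p hp).n) (s : ℝ), (treeGraph p hp).Emits t w s →
      Γ.Emits t (φ (finSuccEquiv m w)) s := by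
    intro w s h
    induction h with
    | start =>
      have : finSuccEquiv m (treeGraph p hp).root = none := Equiv.apply_symm_apply _ _
      rw [this, hroot]
      exact Emits.start
    | step a s _ ih =>
      rw [treeGraph_src, Equiv.apply_symm_apply, ← (harc a).1] at ih
      rw [treeGraph_tgt, Equiv.apply_symm_apply, ← (harc a).2, ← hσ a]
      exact Emits.step (σ a) s ih
  exact key w s h

/-- Every connected rooted graph has at least as many moving points as some tree built from the
same edges whose root has no larger degree. -/
theorem RootedGraph.exists_tree_numPoints_le (Γ : RootedGraph m) (ht : ∀ i, 0 < t i) :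
    ∃ (p : Fin m → Option (Fin m)) (hp : IsParent p),
      (∀ T, (treeGraph p hp).numPoints t T ≤ Γ.numPoints t T) ∧
      (Finset.univ.filter fun e => p e = none).card ≤ Γ.rootDegree := by
  obtain ⟨p, hp, φ, σ, hinj, hσ, hroot, harc⟩ := Γ.exists_unfolding
  have hmap : Function.Injective (fun x : Arc m × ℝ => (σ x.1, x.2)) := by
    rintro ⟨a, s⟩ ⟨b, s'⟩ h
    simp only [Prod.mk.injEq] at h
    rw [hinj h.1, h.2]
  have hem : ∀ (a : Arc m) (s : ℝ), (treeGraph p hp).Emits t ((treeGraph p hp).src a) s →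
      Γ.Emits t (Γ.src (σ a)) s := by
    intro a s h
    have := Emits.of_unfolding hp hσ hroot harc h
    rwa [treeGraph_src, Equiv.apply_symm_apply, ← (harc a).1] at this
  refine ⟨p, hp, fun T => ?_, ?_⟩
  · have h1 : ((treeGraph p hp).pointsAfter t T).ncard ≤ (Γ.pointsAfter t T).ncard := by
      rw [← Set.ncard_image_of_injective _ hmap]
      refine Set.ncard_le_ncard ?_ (finite_pointsAfter Γ ht T)
      rintro _ ⟨⟨a, s⟩, ⟨h1, h2, h3⟩, rfl⟩
      exact ⟨hem a s h1, h2, by simpa only [hσ] using h3⟩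
    have h2 : ((treeGraph p hp).pointsBefore t T).ncard ≤ (Γ.pointsBefore t T).ncard := by
      rw [← Set.ncard_image_of_injective _ hmap]
      refine Set.ncard_le_ncard ?_ (finite_pointsBefore Γ ht T)
      rintro _ ⟨⟨a, s⟩, ⟨h1, h2, h3⟩, rfl⟩
      exact ⟨hem a s h1, h2, by simpa only [hσ] using h3⟩
    unfold numPoints
    gcongr
  · refine Finset.card_le_card_of_injOn (fun e => σ (e, true)) (fun e he => ?_) ?_
    · simp only [Finset.coe_filter, Finset.mem_univ, true_and, Set.mem_ofPred_eq] at he ⊢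
      rw [(harc _).1, ← hroot]
      simp [arcSrc, he]
    · intro e _ f _ h
      exact congrArg Prod.fst (hinj h)

/-- Graphs of minimal growth exist. -/
theorem exists_isMinimalGrowth (ht : ∀ i, 0 < t i) : ∃ Γ : RootedGraph m, Γ.IsMinimalGrowth t := by
  let r : {p : Fin m → Option (Fin m) // IsParent p} → {p : Fin m → Option (Fin m) // IsParent p} →
      Prop := fun p q => ∀ᶠ T in atTop,
    (treeGraph p.1 p.2).numPoints t T < (treeGraph q.1 q.2).numPoints t T
  have htrans : IsTrans _ r := ⟨fun p q s h1 h2 => by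
    filter_upwards [h1, h2] with T h3 h4 using h3.trans h4⟩
  have hirr : Std.Irrefl r := ⟨fun p h => by
    obtain ⟨T, hT⟩ := h.exists
    exact lt_irrefl _ hT⟩
  -- There are finitely many parent functions, so some tree is eventually beaten by no tree. A graph
  -- beating it would unfold to a tree beating it.
  have hwf : WellFounded r := Finite.wellFounded_of_trans_of_irrefl r
  obtain ⟨p, -, hmin⟩ := hwf.has_min Set.univ ⟨⟨fun _ => none, 0, by simp⟩, trivial⟩
  refine ⟨treeGraph p.1 p.2, fun Γ' h => ?_⟩
  obtain ⟨q, hq, hle, -⟩ := Γ'.exists_tree_numPoints_le ht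
  refine hmin ⟨q, hq⟩ trivial ?_
  filter_upwards [h] with T hT using (hle T).trans_lt hT

end Unfolding

/-! ### Combinatorial minimization for equal lengths. -/

section TreeCost

variable {m : ℕ}

open Classical in
/-- The cost of a tree all of whose edges have unit length. -/
noncomputable def treeCost (p : Fin m → Option (Fin m)) : ℕ :=
  ∑ e, (rootPath p (p e)).card + ∑ e : Fin m, ∑ f ∈ leafEdges p, if f = e then 1 else 2

theorem growthCost_const (x : ℝ) (p : Fin m → Option (Fin m)) :
    growthCost (fun _ => x) p = x * x * treeCost p := by
  unfold growthCost treeCost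
  push_cast
  rw [mul_add, Finset.mul_sum, Finset.mul_sum]
  congr 1
  · refine Finset.sum_congr rfl fun e _ => ?_
    rw [Finset.sum_const, nsmul_eq_mul]
    ring
  · refine Finset.sum_congr rfl fun e _ => ?_
    rw [Finset.mul_sum]
    refine Finset.sum_congr rfl fun f _ => ?_
    split_ifs <;> ring

theorem continuous_growthCost (p : Fin m → Option (Fin m)) :
    Continuous fun t : Fin m → ℝ => growthCost t p := by
  unfold growthCost
  refine Continuous.add (by fun_prop) ?_
  refine continuous_finsetSum _ fun e _ => continuous_finsetSum _ fun f _ => ?_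
  split_ifs <;> fun_prop

/-- Moving `c` to the root shortens its path and lengthens none. The sibling `c'` keeps `e` from
becoming a leaf, so the leaf term is unchanged. -/
theorem exists_treeCost_lt_of_branching {p : Fin m → Option (Fin m)} (hp : IsParent p)
    {c c' e : Fin m} (hc : p c = some e) (hc' : p c' = some e) (hne : c' ≠ c) :
    ∃ q : Fin m → Option (Fin m), IsParent q ∧ treeCost q < treeCost p := by
  classical
  obtain ⟨rank, hr⟩ := hp
  set q := Function.update p c none with hq
  have hqc : q c = none := by simp [hq]
  have hqne : ∀ f, f ≠ c → q f = p f := fun f hf => by simp [hq, hf]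
  have hqsome : ∀ f g, q f = some g → p f = some g := by
    intro f g h
    by_cases hf : f = c
    · subst hf; rw [hqc] at h; cases h
    · rwa [hqne f hf] at h
  refine ⟨q, ⟨rank, fun f g h => hr f g (hqsome f g h)⟩, ?_⟩
  have hleaf : leafEdges q = leafEdges p := by
    ext f
    rw [mem_leafEdges, mem_leafEdges]
    constructor
    · intro h g hg
      by_cases hgc : g = c
      · subst hgc
        have : f = e := by rw [hc] at hg; exact (Option.some.inj hg).symm
        subst this
        exact h c' (by rw [hqne _ hne, hc'])
      · exact h g (by rw [hqne _ hgc, hg])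
    · exact fun h g hg => h g (hqsome g f hg)
  have hsub : ∀ f, rootPath q (q f) ⊆ rootPath p (p f) := by
    intro f
    induction hn : rank f using Nat.strong_induction_on generalizing f with
    | _ n ih =>
      subst hn
      cases hqf : q f with
      | none => simp [rootPath_none]
      | some g =>
        rw [hqsome f g hqf, rootPath_some, rootPath_some]
        exact Finset.insert_subset_insert _ (ih _ (hr f g (hqsome f g hqf)) g rfl)
  unfold treeCost
  rw [hleaf]
  refine Nat.add_lt_add_right (Finset.sum_lt_sum (fun f _ => Finset.card_le_card (hsub f))
    ⟨c, Finset.mem_univ c, ?_⟩) _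
  rw [hqc, rootPath_none, hc, rootPath_some]
  simp

/-- Without branching below the root, the parent map is injective from each level to the previous
one, so no level exceeds the root degree. -/
theorem card_depth_lt_le {p : Fin m → Option (Fin m)} (hp : IsParent p)
    (hinj : ∀ c c' e, p c = some e → p c' = some e → c' = c) (j : ℕ) :
    (Finset.univ.filter fun e => (rootPath p (p e)).card < j).card ≤
      j * (Finset.univ.filter fun e => p e = none).card := by
  classical
  have hlevel : ∀ j, (Finset.univ.filter fun e => (rootPath p (p e)).card = j).card ≤
      (Finset.univ.filter fun e => p e = none).card := by
    intro j
    induction j with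
    | zero =>
      refine Finset.card_le_card fun e he => ?_
      simp only [Finset.mem_filter, Finset.mem_univ, true_and, Finset.card_eq_zero] at he ⊢
      cases hpe : p e with
      | none => rfl
      | some g => rw [hpe, rootPath_some] at he; simp at he
    | succ j ih =>
      refine le_trans (Finset.card_le_card_of_injOn (fun e => (p e).getD e) ?_ ?_) ih
      · intro e he
        simp only [Finset.coe_filter, Finset.mem_univ, true_and, Set.mem_ofPred_eq] at he ⊢
        cases hpe : p e with
        | none => rw [hpe, rootPath_none] at he; simp at he
        | some g =>
          rw [hpe, rootPath_some, Finset.card_insert_of_notMem (notMem_rootPath hp g)] at he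
          simpa using he
      · intro c hc c' hc' h
        simp only [Finset.coe_filter, Finset.mem_univ, true_and, Set.mem_ofPred_eq] at hc hc' h
        cases hpc : p c with
        | none => rw [hpc, rootPath_none] at hc; simp at hc
        | some g =>
          cases hpc' : p c' with
          | none => rw [hpc', rootPath_none] at hc'; simp at hc'
          | some g' =>
            rw [hpc, hpc'] at h
            simp only [Option.getD_some] at h
            subst h
            exact hinj c' c g hpc' hpc
  induction j with
  | zero => simp
  | succ j ih =>
    have : (Finset.univ.filter fun e => (rootPath p (p e)).card < j + 1) ⊆
        (Finset.univ.filter fun e => (rootPath p (p e)).card < j) ∪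
        (Finset.univ.filter fun e => (rootPath p (p e)).card = j) := by
      intro e he
      simp only [Finset.mem_union, Finset.mem_filter, Finset.mem_univ, true_and] at he ⊢
      omega
    calc _ ≤ _ := Finset.card_le_card this
      _ ≤ _ := Finset.card_union_le _ _
      _ ≤ _ := by rw [Nat.succ_mul]; exact Nat.add_le_add ih (hlevel j)

/-- The spider with `s` legs of nearly equal lengths. -/
def spider (m s : ℕ) (i : Fin m) : Option (Fin m) :=
  if (i : ℕ) < s then none else some ⟨i - s, by omega⟩

theorem spider_eq_some {s : ℕ} {e f : Fin m} (h : spider m s e = some f) :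
    (f : ℕ) + s = e := by
  unfold spider at h
  split_ifs at h with h1
  have := congrArg Fin.val (Option.some.inj h)
  simp only at this
  omega

theorem isParent_spider {s : ℕ} (hs : 0 < s) : IsParent (spider m s) :=
  ⟨fun i => i, fun e f h => by have := spider_eq_some h; show (f : ℕ) < e; omega⟩

theorem treeCost_spider_le {s : ℕ} (hs : 0 < s) :
    treeCost (spider m s) ≤ m * (m / s) + m * (s * 2) := by
  classical
  have hdepth : ∀ e : Fin m, (rootPath (spider m s) (spider m s e)).card ≤ (e : ℕ) / s := by
    intro e
    induction hn : (e : ℕ) using Nat.strong_induction_on generalizing e with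
    | _ n ih =>
      subst hn
      cases h : spider m s e with
      | none => simp [rootPath_none]
      | some f =>
        have hfe := spider_eq_some h
        rw [rootPath_some]
        refine (Finset.card_insert_le _ _).trans ?_
        rw [← hfe, Nat.add_div_right _ hs]
        exact Nat.succ_le_succ (ih f (by omega) f rfl)
  have hleaf : (leafEdges (spider m s)).card ≤ s := by
    rw [← Finset.card_range s]
    -- Only the last `s` edges can be leaves, because any other `f` has the child `f + s`.
    refine Finset.card_le_card_of_injOn (fun i : Fin m => m - 1 - i) (fun f hf => ?_) ?_
    · have hf' := mem_leafEdges.1 (Finset.mem_coe.1 hf)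
      by_contra hcon
      simp only [Finset.coe_range, Set.mem_Iio, not_lt] at hcon
      refine hf' ⟨f + s, by omega⟩ ?_
      simp [spider]
    · intro f _ g _ h
      simp only at h
      omega
  unfold treeCost
  refine Nat.add_le_add ?_ ?_
  · calc ∑ e, (rootPath (spider m s) (spider m s e)).card ≤ ∑ _e : Fin m, m / s :=
        Finset.sum_le_sum fun e _ => (hdepth e).trans (Nat.div_le_div_right e.2.le)
      _ = _ := by simp
  · calc (∑ e : Fin m, ∑ f ∈ leafEdges (spider m s), if f = e then 1 else 2)
        ≤ ∑ _e : Fin m, ∑ _f ∈ leafEdges (spider m s), 2 := by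
          gcongr; split_ifs <;> omega
      _ = m * ((leafEdges (spider m s)).card * 2) := by simp
      _ ≤ _ := by gcongr

/-- A tree with many edges and a root of small degree does not have the least cost. -/
theorem exists_treeCost_lt {d : ℕ} (hm : 200 * d ^ 2 ≤ m) {p : Fin m → Option (Fin m)}
    (hp : IsParent p) (hd : (Finset.univ.filter fun e => p e = none).card < d) :
    ∃ q : Fin m → Option (Fin m), IsParent q ∧ treeCost q < treeCost p := by
  by_cases hbr : ∃ c c' e, p c = some e ∧ p c' = some e ∧ c' ≠ c
  · obtain ⟨c, c', e, h1, h2, h3⟩ := hbr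
    exact exists_treeCost_lt_of_branching hp h1 h2 h3
  push Not at hbr
  have hd0 : 0 < d := by omega
  -- At least half of the edges have depth at least `J`, about `m / (2 * d)`, while the spider costs
  -- at most `m * (K + 16 * d)` with `K` about `m / (8 * d)`. The needed inequality `2 * (K + 16 *
  -- d) < J` follows from `m / (4 * d) ≥ 50 * d`.
  refine ⟨spider m (8 * d), isParent_spider (by omega), ?_⟩
  refine (treeCost_spider_le (by omega)).trans_lt ?_
  set J := m / (2 * d) with hJ
  have hcard := card_depth_lt_le hp hbr J
  set A := Finset.univ.filter fun e => (rootPath p (p e)).card < J with hA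
  have hAd : A.card ≤ J * d := hcard.trans (Nat.mul_le_mul_left _ hd.le)
  have hAc : (Finset.univ.filter fun e => ¬ (rootPath p (p e)).card < J).card = m - A.card := by
    have := Finset.card_filter_add_card_filter_not (s := (Finset.univ : Finset (Fin m)))
      (fun e => (rootPath p (p e)).card < J)
    rw [Finset.card_univ, Fintype.card_fin, ← hA] at this
    omega
  have hcost : J * (m - A.card) ≤ treeCost p := by
    unfold treeCost
    refine le_trans ?_ (Nat.le_add_right _ _)
    rw [← hAc, mul_comm, ← smul_eq_mul]
    refine le_trans (Finset.card_nsmul_le_sum _ (fun e => (rootPath p (p e)).card) J ?_)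
      (Finset.sum_le_sum_of_subset (Finset.filter_subset _ _))
    intro e he
    simpa using he
  refine lt_of_lt_of_le ?_ hcost
  have hJ1 : J * (2 * d) ≤ m := Nat.div_mul_le_self _ _
  have hJ2 : m < (J + 1) * (2 * d) := by
    rw [mul_comm]; exact Nat.lt_mul_div_succ m (by omega)
  set K := m / (8 * d) with hK
  have hK1 : K * (8 * d) ≤ m := Nat.div_mul_le_self _ _
  have hAm : m ≤ 2 * (m - A.card) := by
    have : 2 * (J * d) ≤ m := by linarith
    omega
  have hmpos : 0 < m := by nlinarith
  suffices h : 2 * (K + 8 * d * 2) < J by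
    have : m * K + m * (8 * d * 2) = m * (K + 8 * d * 2) := by ring
    rw [this]
    calc m * (K + 8 * d * 2) ≤ 2 * (m - A.card) * (K + 8 * d * 2) := by gcongr
      _ = (m - A.card) * (2 * (K + 8 * d * 2)) := by ring
      _ < (m - A.card) * J := by
        refine Nat.mul_lt_mul_of_pos_left h (by omega)
      _ = _ := mul_comm _ _
  by_contra hcon
  push Not at hcon
  nlinarith

end TreeCost

/-! ### Choice of the lengths and conclusion. -/

theorem exists_linearIndependent_near (m : ℕ) {x δ : ℝ} (hx : 0 < x) (hδ : 0 < δ) :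
    ∃ t : Fin m → ℝ, (∀ i, 0 < t i ∧ |t i - x| < δ) ∧ LinearIndependent ℚ t := by
  have hrank : (m : Cardinal) ≤ Module.rank ℚ ℝ := by
    rw [Real.rank_rat_real]
    exact (Cardinal.natCast_lt_aleph0.trans Cardinal.aleph0_lt_continuum).le
  -- Nonzero rational rescaling preserves independence, and the rational multiples of each `b i` are
  -- dense.
  obtain ⟨b, hb⟩ := Module.le_rank_iff.1 hrank
  have hη : 0 < min x δ := lt_min hx hδ
  have hq : ∀ i, ∃ q : ℚ, |q * b i - x| < min x δ := by
    intro i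
    have hbi : 0 < |b i| := abs_pos.2 (hb.ne_zero i)
    obtain ⟨q, hq⟩ := exists_rat_near (x / b i) (div_pos hη hbi)
    refine ⟨q, ?_⟩
    rw [lt_div_iff₀ hbi, ← abs_mul, sub_mul, div_mul_cancel₀ _ (hb.ne_zero i), abs_sub_comm] at hq
    exact hq
  choose q hq using hq
  have hpos : ∀ i, 0 < q i * b i := fun i => by
    have := (abs_lt.1 ((hq i).trans_le (min_le_left _ _))).1
    linarith
  have hq0 : ∀ i, q i ≠ 0 := by
    intro i h
    have := hpos i
    rw [h] at this
    simp at this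
  refine ⟨fun i => q i * b i, fun i => ⟨hpos i, (hq i).trans_le (min_le_right _ _)⟩, ?_⟩
  have h1 := hb.units_smul fun i => Units.mk0 (q i) (hq0 i)
  convert h1 using 2 with i
  simp [Units.smul_def, Rat.smul_def]

theorem mainTheorem2 (d : ℕ) :
    ∃ m₀ : ℕ, ∀ m : ℕ, m₀ ≤ m → ∀ x : ℝ, 0 < x → ∀ ε : ℝ, 0 < ε →
      ∃ t : Fin m → ℝ,
        (∀ i, 0 < t i ∧ |t i - x| < ε) ∧
        LinearIndependent ℚ t ∧
        (∃ Γ : RootedGraph m, Γ.IsMinimalGrowth t) ∧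
        ∀ Γ : RootedGraph m, Γ.IsMinimalGrowth t → d ≤ Γ.rootDegree := by
  -- The extra `3` gives `1 ≤ n`, so that two edges of irrational length ratio remain after one is
  -- removed.
  refine ⟨200 * d ^ 2 + 3, fun m hm x hx ε hε => ?_⟩
  obtain ⟨n, rfl⟩ : ∃ n, m = n + 2 := ⟨m - 2, by omega⟩
  have hcost : ∀ᶠ t : Fin (n + 2) → ℝ in 𝓝 (fun _ => x),
      ∀ p q : Fin (n + 2) → Option (Fin (n + 2)), treeCost q < treeCost p →
        growthCost t q < growthCost t p := by
    refine eventually_all.2 fun p => eventually_all.2 fun q => eventually_imp_distrib_left.2 ?_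
    intro hqp
    refine (continuous_growthCost q).continuousAt.eventually_lt
      (continuous_growthCost p).continuousAt ?_
    rw [growthCost_const, growthCost_const]
    have : (treeCost q : ℝ) < treeCost p := Nat.cast_lt.2 hqp
    gcongr
  obtain ⟨δ, hδ, hball⟩ := Metric.eventually_nhds_iff.1 hcost
  obtain ⟨t, ht, hli⟩ := exists_linearIndependent_near (n + 2) hx (lt_min hδ hε)
  have hpos : ∀ i, 0 < t i := fun i => (ht i).1
  have hclose : dist t (fun _ => x) < δ := by
    rw [dist_pi_lt_iff hδ]
    exact fun i => (ht i).2.trans_le (min_le_left _ _)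
  refine ⟨t, fun i => ⟨hpos i, (ht i).2.trans_le (min_le_right _ _)⟩, hli,
    exists_isMinimalGrowth hpos, fun Γ hΓ => ?_⟩
  by_contra hdeg
  push Not at hdeg
  obtain ⟨p, hp, hle, hroot⟩ := Γ.exists_tree_numPoints_le hpos
  obtain ⟨q, hq, hqp⟩ := exists_treeCost_lt (by omega) hp (hroot.trans_lt hdeg)
  refine hΓ (treeGraph q hq) ?_
  filter_upwards [eventually_numPoints_lt_of_growthCost_lt hp hq (by omega) hpos hli
    (hball hclose p q hqp)] with T hT using hT.trans_le (hle T)
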